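/- **Setting.** Let $q_0=(1/\sqrt3,1)$, $q_1=(0,0)$, $q_2=(2/\sqrt3,0)$, $F_i(z)=\frac12(z+q_i)$, and let $\mathcal{SG}\subset\mathbb R^2$ be the Sierpinski gasket, the unique nonempty compact set with $\mathcal{SG}=\bigcup_{i=0}^2F_i\mathcal{SG}$. Put $V_0=\{q_0,q_1,q_2\}$, $V_{m+1}=\bigcup_iF_iV_m$, and $F_w=F_{w_1}\circ\cdots\circ F_{w_m}$ for a word $w=w_1\cdots w_m$ in the letters $0,1,2$, with $|w|=m$; the sets $F_w\mathcal{SG}$ with $|w|=m$ are the $m$-cells. For $0\le\lambda<1$ write $\lambda=\sum_{k\ge1}e_k(\lambda)2^{-k}$ with $e_k(\lambda)\in\{0,1\}$ not ending in infinitely many consecutive $1$s, and $S\lambda=\sum_{k\ge1}e_{k+1}(\lambda)2^{-k}$. The lower domain is $\Omega_\lambda^-=\{(x,y)\in\mathcal{SG}\setminus V_0: y<1-\lambda\}$, with boundary $X\cup\{q_1,q_2\}$, where $X=X_\lambda^-$ is $\{(x,y)\in\mathcal{SG}:y=1-\lambda\}$ if $\lambda$ is not a dyadic rational, and is the intersection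 of that set with $V_{d}$ if $\lambda$ is a dyadic rational and $d\ge 0$ is the smallest integer such that $\lambda\in2^{-d}\mathbb Z$. Let $\bar\Omega_\lambda^-=\Omega_\lambda^-\cup X\cup\{q_1,q_2\}$. A continuous function $u$ on $\bar\Omega_\lambda^-$ is *harmonic* if for every $m\ge1$ one has $\sum_{y\sim_mx}(u(x)-u(y))=0$ at each vertex $x\in V_m\setminus V_0$ for which both $m$-cells containing $x$ lie in $\bar\Omega_\lambda^-$; here $y\sim_m x$ runs over the other vertices of these two cells. For $i\in\{1,2\}$ (indices mod $3$) let $$\partial_nu(q_i)=\lim_{n\to\infty}(5/3)^n\big(2u(q_i)-u(F_i^nq_{i+1})-u(F_i^nq_{i-1})\big),\qquad \partial_nu(F_wq_i)=(5/3)^{|w|}\,\partial_n(u\circ F_w)(q_i),$$ the latter with respect to the cell $F_w\mathcal{SG}$; write $\partial_n^\leftarrow u(F_wq_1)$ and $\partial_n^\rightarrow u(F_wq_2)$ for $i=1,2$. Let $h_1^\lambda$ be the harmonic function on $\bar\Omega_\lambda^-$ with $h_1^\lambda(q_1)=1$, $h_1^\lambda(q_2)=0$, $h_1^\lambda|_X=0$,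 and put $\eta_1(\lambda)=\partial_n^\leftarrow h_1^\lambda(q_1)$, $\eta_2(\lambda)=-\partial_n^\rightarrow h_1^\lambda(q_2)$. Let $\tilde W_m^\lambda$ be the set of words $w$ of length $m$ with $w_k=0$ if $e_k(\lambda)=0$ and $w_k\in\{1,2\}$ if $e_k(\lambda)=1$. With $a=\eta_1(S\lambda)$, $b=\eta_2(S\lambda)$ put $$M_0^\lambda=\frac1{6+4a+4b}\begin{pmatrix}3+3a+3b&3+a+b\\3+a+b&3+3a+3b\end{pmatrix},\quad M_1^\lambda=\begin{pmatrix}1&0\\-\frac b{2a}&\frac b{2a}\end{pmatrix},\quad M_2^\lambda=\begin{pmatrix}\frac b{2a}&-\frac b{2a}\\0&1\end{pmatrix},$$ and $M_w^\lambda=M_{w_m}^{S^{m-1}\lambda}\cdots M_{w_2}^{S\lambda}M_{w_1}^\lambda$ for $w\in\tilde W_m^\lambda$ (the identity matrix for $m=0$). **Proposition 4.9.** Let $0\le\lambda<1$ and $m\ge0$ with $e_1(\lambda)=\dots=e_m(\lambda)=1$. Then the equation $$\frac{\eta_1(S^m\lambda)}{\eta_2(S^m\lambda)}=\frac{x+x^{-1}}2$$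 has exactly one solution $x\in(0,1)$, and for this $x$ the following hold. (a) $$\eta_1(\lambda)=\Big(\frac53\Big)^m\frac{x-x^{-1}}{x+x^{-1}}\cdot\frac{x^{2^m}+x^{-2^m}}{x^{2^m}-x^{-2^m}}\,\eta_1(S^m\lambda),\qquad \eta_2(\lambda)=\Big(\frac53\Big)^m\frac{x-x^{-1}}{x^{2^m}-x^{-2^m}}\,\eta_2(S^m\lambda).$$ (b) For every $w\in\tilde W_m^\lambda$, the matrix $M_w^\lambda$, which satisfies $$\begin{pmatrix}\partial_n^\leftarrow h(F_wq_1)\\\partial_n^\rightarrow h(F_wq_2)\end{pmatrix}=M_w^\lambda\begin{pmatrix}\partial_n^\leftarrow h(q_1)\\\partial_n^\rightarrow h(q_2)\end{pmatrix}$$ for every harmonic function $h$ on $\bar\Omega_\lambda^-$ with $h|_X=0$, is given by $$M_w^\lambda=\begin{pmatrix}x^j&-x^{2^m-j}\\-x^{j+1}&x^{2^m-j-1}\end{pmatrix}\begin{pmatrix}1&-x^{2^m}\\-x^{2^m}&1\end{pmatrix}^{-1},$$ where $j=\sum_{k=1}^m(w_k-1)2^{m-k}$ is an integer with $0\le j\le2^m-1$.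 -/

import Mathlib

open Filter Topology

noncomputable section

namespace Gasket

/-! ### The Sierpinski gasket in the plane -/

/-- The boundary vertices `q₀ = (1/√3, 1)`, `q₁ = (0, 0)`, `q₂ = (2/√3, 0)`. -/
def q : Fin 3 → ℝ × ℝ := ![(1 / √3, 1), (0, 0), (2 / √3, 0)]

/-- The contraction `F_i` of ratio `1/2` with fixed point `q_i`. -/
def F (i : Fin 3) (z : ℝ × ℝ) : ℝ × ℝ := (1 / 2 : ℝ) • (z + q i)

/-- `F_w = F_{w₁} ∘ ⋯ ∘ F_{w_m}` for a word `w = w₁ ⋯ w_m` in the letters `0, 1, 2`. -/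
def Fw : List (Fin 3) → ℝ × ℝ → ℝ × ℝ
  | [] => id
  | i :: w => F i ∘ Fw w

/-- The vertex sets: `V₀ = {q₀, q₁, q₂}` and `V_{m+1} = ⋃ᵢ F_i V_m`. -/
def V : ℕ → Set (ℝ × ℝ)
  | 0 => Set.range q
  | m + 1 => ⋃ i : Fin 3, F i '' V m

/-- The Sierpinski gasket, as the closure of `V_* = ⋃ₘ V_m`. The theorem `SG_spec` below identifies
it as the unique nonempty compact set `K` with `K = F₀ K ∪ F₁ K ∪ F₂ K`. -/
def SG : Set (ℝ × ℝ) := closure (⋃ m, V m)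

theorem dist_F (i : Fin 3) (x y : ℝ × ℝ) : dist (F i x) (F i y) = 1 / 2 * dist x y := by
  simp [F, dist_smul₀]

theorem continuous_F (i : Fin 3) : Continuous (F i) := by
  unfold F; fun_prop

theorem F_q (i : Fin 3) : F i (q i) = q i := by
  ext <;> simp [F] <;> ring

theorem V_subset_of_selfSimilar {K : Set (ℝ × ℝ)} (hne : K.Nonempty) (hK : IsClosed K)
    (h : ∀ i, F i '' K ⊆ K) (m : ℕ) : V m ⊆ K := by
  induction m with
  | zero =>
    rintro _ ⟨i, rfl⟩
    obtain ⟨p, hp⟩ := hne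
    have hmem : ∀ n, (F i)^[n] p ∈ K := by
      intro n
      induction n with
      | zero => exact hp
      | succ n ih => rw [Function.iterate_succ_apply']; exact h i ⟨_, ih, rfl⟩
    have hd : ∀ n, dist ((F i)^[n] p) (q i) = (1 / 2) ^ n * dist p (q i) := by
      intro n
      induction n with
      | zero => simp
      | succ n ih =>
        rw [Function.iterate_succ_apply']
        nth_rewrite 1 [← F_q i]
        rw [dist_F, ih]; ring
    refine hK.mem_of_tendsto (b := atTop) (tendsto_iff_dist_tendsto_zero.2 ?_) (Eventually.of_forall hmem)
    simp_rw [hd]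
    simpa using (tendsto_pow_atTop_nhds_zero_of_lt_one (r := (1 / 2 : ℝ)) (by norm_num)
      (by norm_num)).mul_const (dist p (q i))
  | succ m ih =>
    exact Set.iUnion_subset fun i => (Set.image_mono ih).trans (h i)

theorem SG_selfSimilar : SG = ⋃ i, F i '' SG := by
  have himg : ∀ i, F i '' SG = closure (F i '' ⋃ m, V m) := by
    intro i
    have hc : Topology.IsClosedEmbedding (F i) := by
      have hF : F i = fun z => (1 / 2 : ℝ) • (z + q i) := rfl
      rw [hF]
      exact ((Homeomorph.addRight (q i)).trans
        (Homeomorph.smulOfNeZero (1 / 2 : ℝ) (by norm_num))).isClosedEmbedding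
    exact hc.isClosedMap.closure_image_eq_of_continuous hc.continuous _ |>.symm
  have hV : (⋃ m, V m) = ⋃ i, F i '' ⋃ m, V m := by
    apply Set.Subset.antisymm
    · refine Set.iUnion_subset fun m => ?_
      cases m with
      | zero =>
        rintro _ ⟨i, rfl⟩
        exact Set.mem_iUnion.2 ⟨i, q i, Set.mem_iUnion.2 ⟨0, i, rfl⟩, F_q i⟩
      | succ m =>
        exact Set.iUnion_mono fun i => Set.image_mono (Set.subset_iUnion V m)
    · refine Set.iUnion_subset fun i => ?_
      rw [Set.image_iUnion]
      exact Set.iUnion_subset fun m => (Set.subset_iUnion (fun i => F i '' V m) i).trans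
        (Set.subset_iUnion V (m + 1))
  simp_rw [himg]
  rw [SG, hV, closure_iUnion_of_finite]
  simp_rw [← hV]

/-- The gasket is the unique nonempty compact set invariant under the three contractions. -/
theorem SG_spec (K : Set (ℝ × ℝ)) :
    (K.Nonempty ∧ IsCompact K ∧ K = ⋃ i, F i '' K) ↔ K = SG := by
  have hSG : ∀ i, F i '' SG ⊆ SG := fun i => by
    conv_rhs => rw [SG_selfSimilar]
    exact Set.subset_iUnion (fun i => F i '' SG) i
  have hq0 : q 0 ∈ SG := subset_closure (Set.mem_iUnion.2 ⟨0, 0, rfl⟩)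
  constructor
  · rintro ⟨hne, hc, hK⟩
    have hsub : ∀ i, F i '' K ⊆ K := fun i => by
      conv_rhs => rw [hK]
      exact Set.subset_iUnion (fun i => F i '' K) i
    apply Set.Subset.antisymm
    · obtain ⟨D, hD⟩ := hc.isBounded.subset_closedBall (q 0)
      have key : ∀ n : ℕ, ∀ p ∈ K, ∃ s ∈ SG, dist p s ≤ (1 / 2) ^ n * D := by
        intro n
        induction n with
        | zero => intro p hp; exact ⟨q 0, hq0, by simpa using hD hp⟩
        | succ n ih =>
          intro p hp
          rw [hK] at hp
          obtain ⟨i, p', hp', rfl⟩ := Set.mem_iUnion.1 hp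
          obtain ⟨s, hs, hds⟩ := ih p' hp'
          refine ⟨F i s, hSG i ⟨s, hs, rfl⟩, ?_⟩
          rw [dist_F, pow_succ]
          linarith
      intro p hp
      choose s hs hds using fun n => key n p hp
      refine isClosed_closure.mem_of_tendsto (f := s) (b := atTop)
        (tendsto_iff_dist_tendsto_zero.2 ?_) (Eventually.of_forall hs)
      refine squeeze_zero (fun _ => dist_nonneg) (fun n => (dist_comm _ _).trans_le (hds n)) ?_
      simpa using (tendsto_pow_atTop_nhds_zero_of_lt_one (r := (1 / 2 : ℝ)) (by norm_num)
        (by norm_num)).mul_const D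
    · exact closure_minimal (Set.iUnion_subset fun m =>
        V_subset_of_selfSimilar hne hc.isClosed hsub m) hc.isClosed
  · rintro rfl
    refine ⟨⟨_, hq0⟩, ?_, SG_selfSimilar⟩
    have hbox : ∀ m, V m ⊆ Set.Icc ((0 : ℝ), (0 : ℝ)) (2 / √3, 1) := by
      have h3 : (0 : ℝ) ≤ (√3)⁻¹ := by positivity
      have hdiv : (2 : ℝ) / √3 = 2 * (√3)⁻¹ := div_eq_mul_inv _ _
      refine V_subset_of_selfSimilar ⟨(0, 0), ?_⟩ isClosed_Icc ?_
      · simp only [Set.mem_Icc, Prod.mk_le_mk, hdiv]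
        refine ⟨⟨le_rfl, le_rfl⟩, ?_, zero_le_one⟩
        positivity
      · rintro i _ ⟨⟨x, y⟩, h, rfl⟩
        simp only [Set.mem_Icc, Prod.mk_le_mk, hdiv] at h
        obtain ⟨⟨hx0, hy0⟩, hx1, hy1⟩ := h
        fin_cases i <;> simp [F, q, hdiv, Prod.le_def] <;> constructor <;> constructor <;>
          linarith
    exact isCompact_Icc.of_isClosed_subset isClosed_closure
      (closure_minimal (Set.iUnion_subset hbox) isClosed_Icc)

/-! ### Lower domains -/

/-- The `k`-th binary digit `e_k(λ)`, `k ≥ 1`, of `λ ∈ [0, 1)`; the expansion which does not end in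
infinitely many consecutive `1`s. -/
def digit (lam : ℝ) (k : ℕ) : ℕ := ⌊2 ^ k * lam⌋₊ % 2

/-- The shift `Sλ = ∑ e_{k+1}(λ) 2^{-k}`, that is, the fractional part of `2λ`. -/
def shift (lam : ℝ) : ℝ := Int.fract (2 * lam)

/-- For `λ ∈ [0, 1)`, the digits `digit λ k`, `k ≥ 1`, are a binary expansion of `λ`. -/
theorem hasSum_digit {lam : ℝ} (h0 : 0 ≤ lam) (h1 : lam < 1) :
    HasSum (fun k : ℕ => (digit lam (k + 1) : ℝ) * ((2 : ℝ) ^ (k + 1))⁻¹) lam := by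
  have h := Real.hasSum_ofDigitsTerm_digits lam (b := 2) (by norm_num) ⟨h0, h1⟩
  convert h using 2 with k
  simp [Real.ofDigitsTerm, Real.digits, digit, mul_comm]

/-- The shift `Sλ` is again in `[0, 1)`. -/
theorem shift_mem (lam : ℝ) : 0 ≤ shift lam ∧ shift lam < 1 :=
  ⟨Int.fract_nonneg _, Int.fract_lt_one _⟩

/-- The binary digits of `Sλ` are those of `λ`, shifted by one place. -/
theorem digit_shift {lam : ℝ} (h0 : 0 ≤ lam) {k : ℕ} (hk : 1 ≤ k) :
    digit (shift lam) k = digit lam (k + 1) := by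
  obtain ⟨k, rfl⟩ := Nat.exists_eq_add_of_le' hk
  have hfl : ((⌊2 * lam⌋₊ : ℕ) : ℝ) = ((⌊2 * lam⌋ : ℤ) : ℝ) :=
    natCast_floor_eq_intCast_floor (by positivity)
  have hS : 2 ^ (k + 1 + 1) * lam =
      2 ^ (k + 1) * shift lam + ((2 * (2 ^ k * ⌊2 * lam⌋₊) : ℕ) : ℝ) := by
    have := Int.fract_add_floor (2 * lam)
    push_cast
    rw [shift, hfl]
    linear_combination (-2 ^ (k + 1) : ℝ) * this
  unfold digit
  rw [hS, Nat.floor_add_natCast (mul_nonneg (by positivity) (shift_mem lam).1)]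
  omega

/-- `λ` is a dyadic rational. -/
def IsDyadic (lam : ℝ) : Prop := ∃ n : ℕ, ∃ k : ℤ, lam = k * (2 ^ n)⁻¹

/-- The smallest `d` such that the dyadic rational `λ` is a multiple of `2^{-d}`. -/
def dyadicLevel (lam : ℝ) : ℕ := sInf {n : ℕ | ∃ k : ℤ, lam = k * (2 ^ n)⁻¹}

/-- The open lower domain `Ω_λ⁻ = {(x, y) ∈ SG ∖ V₀ : y < 1 - λ}`. -/
def Omega (lam : ℝ) : Set (ℝ × ℝ) := {p | p ∈ SG ∧ p ∉ V 0 ∧ p.2 < 1 - lam}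

/-- The part `X` of the boundary of `Ω_λ⁻` on the cut `y = 1 - λ`: all points of the gasket on the
cut if `λ` is not dyadic, and only those in `V_{d(λ)}` if `λ` is dyadic. -/
def X (lam : ℝ) : Set (ℝ × ℝ) :=
  {p | p ∈ SG ∧ p.2 = 1 - lam ∧ (IsDyadic lam → p ∈ V (dyadicLevel lam))}

/-- The closed domain `Ω_λ⁻ ∪ ∂Ω_λ⁻`, where `∂Ω_λ⁻ = X ∪ {q₁, q₂}`. -/
def OmegaBar (lam : ℝ) : Set (ℝ × ℝ) := Omega lam ∪ (X lam ∪ {q 1, q 2})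

/-- The words `W̃_m^λ` of length `m`: the `k`-th letter is `0` if `e_k(λ) = 0`, and is `1` or `2` if
`e_k(λ) = 1`. -/
def words (lam : ℝ) (m : ℕ) : Set (List (Fin 3)) :=
  {w | w.length = m ∧ ∀ (k : ℕ) (hk : k < w.length),
    (digit lam (k + 1) = 0 → w[k] = 0) ∧ (digit lam (k + 1) = 1 → w[k] = 1 ∨ w[k] = 2)}

/-! ### Harmonic functions and normal derivatives -/

/-- `u` is a continuous function on the closed lower domain which is harmonic in `Ω_λ⁻`: at every
level `m`, the mean value property `∑_{y ∼_m x} (u x - u y) = 0` holds at each vertex `x` of `V_m`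
around which both `m`-cells are contained in the closed domain. A vertex of `V_m ∖ V₀` is the common
vertex `x = F_w q_i = F_{w'} q_{i'}` of exactly two `m`-cells, and its neighbours are the other two
vertices of each of them. (Such an `x` automatically lies in `Ω_λ⁻`.) -/
structure IsHarmonic (lam : ℝ) (u : ℝ × ℝ → ℝ) : Prop where
  continuousOn : ContinuousOn u (OmegaBar lam)
  mean_value : ∀ (w w' : List (Fin 3)) (i i' : Fin 3), w.length = w'.length → w ≠ w' →
    Fw w (q i) = Fw w' (q i') → Fw w '' SG ⊆ OmegaBar lam → Fw w' '' SG ⊆ OmegaBar lam →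
    (u (Fw w (q i)) - u (Fw w (q (i + 1)))) + (u (Fw w (q i)) - u (Fw w (q (i + 2)))) +
      (u (Fw w' (q i')) - u (Fw w' (q (i' + 1)))) +
      (u (Fw w' (q i')) - u (Fw w' (q (i' + 2)))) = 0

/-- The normal derivative at `q_i` (indices of the vertices modulo `3`):
`∂ₙu(q_i) = lim (5/3)^n (2 u(q_i) - u(F_i^n q_{i+1}) - u(F_i^n q_{i-1}))`. -/
def normalDeriv (u : ℝ × ℝ → ℝ) (i : Fin 3) : ℝ :=
  limUnder atTop fun n : ℕ =>
    (5 / 3 : ℝ) ^ n * (2 * u (q i) - u ((F i)^[n] (q (i + 1))) - u ((F i)^[n] (q (i - 1))))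

/-- The normal derivative at the vertex `F_w q_i` with respect to the cell `F_w SG`:
`(5/3)^{|w|} ∂ₙ(u ∘ F_w)(q_i)`. For `i = 1` this is `∂ₙ^← u(F_w q₁)`, and for `i = 2` it is
`∂ₙ^→ u(F_w q₂)`. -/
def cellNormalDeriv (u : ℝ × ℝ → ℝ) (w : List (Fin 3)) (i : Fin 3) : ℝ :=
  (5 / 3 : ℝ) ^ w.length * normalDeriv (u ∘ Fw w) i

/-- `h` is the harmonic function on the lower domain with `h(q₁) = 1`, `h(q₂) = 0`, `h|_X = 0`. -/
def IsH1 (lam : ℝ) (h : ℝ × ℝ → ℝ) : Prop :=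
  IsHarmonic lam h ∧ h (q 1) = 1 ∧ h (q 2) = 0 ∧ ∀ p ∈ X lam, h p = 0

/-- The harmonic function `h₁^λ` (only its values on the closed lower domain matter). -/
def h1 (lam : ℝ) : ℝ × ℝ → ℝ := Classical.epsilon (IsH1 lam)

/-- `η₁(λ) = ∂ₙ^← h₁^λ(q₁)`. -/
def eta1 (lam : ℝ) : ℝ := normalDeriv (h1 lam) 1

/-- `η₂(λ) = -∂ₙ^→ h₁^λ(q₂)`. -/
def eta2 (lam : ℝ) : ℝ := -normalDeriv (h1 lam) 2

/-! ### The matrices `M_w^λ` -/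

/-- The matrices `M₀^λ`, `M₁^λ`, `M₂^λ`. -/
def M (lam : ℝ) : Fin 3 → Matrix (Fin 2) (Fin 2) ℝ :=
  let a := eta1 (shift lam)
  let b := eta2 (shift lam)
  ![!![(3 + 3 * a + 3 * b) / (6 + 4 * a + 4 * b), (3 + a + b) / (6 + 4 * a + 4 * b);
       (3 + a + b) / (6 + 4 * a + 4 * b), (3 + 3 * a + 3 * b) / (6 + 4 * a + 4 * b)],
    !![1, 0; -(b / (2 * a)), b / (2 * a)],
    !![b / (2 * a), -(b / (2 * a)); 0, 1]]

/-- `M_w^λ = M_{w_m}^{S^{m-1}λ} ⋯ M_{w₂}^{Sλ} M_{w₁}^λ` for `w = w₁ ⋯ w_m`. -/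
def Mw (lam : ℝ) : List (Fin 3) → Matrix (Fin 2) (Fin 2) ℝ
  | [] => 1
  | i :: w => Mw (shift lam) w * M lam i

end Gasket

end

/-!
The lower domain of `λ` is self-similar. If the first digit of `λ` is `1`, it consists of two copies
of the lower domain of `Sλ` which share one vertex; if it is `0`, of one such copy on top of two full
cells of level one. For functions that vanish on the cut `X`, the domain acts as a symmetric network
with the two terminals `q₁`, `q₂`, whose Dirichlet-to-Neumann map is given by two numbers: `near` and
`far`, or equivalently its eigenvalues `sig = near - far` and `del = near + far`. The gluing turns
the eigenvalues of `Sλ` into those of `λ` by an explicit monotone map; its iterates from the values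
`(1, 3)` of the full gasket increase and are bounded, because every `λ < 1` has a digit `0`. Their
limits satisfy `1 ≤ sig < del`.

From these numbers the harmonic functions `sol λ α β` are built by subdivision (`solApprox`).
Every digit `0` contracts, which yields uniform convergence, continuity and the zero values on `X`.
The difference quotients at `q₁` and `q₂` are constant once the cell lies in the domain
(`flux_sol_one`, `flux_sol_two`), so the mean value property reduces to a balance of normal
derivatives at the vertices of level one (`isHarmonic_sol`). Uniqueness at the vertices is a maximum
principle (`IsHarmonic.nonpos`). Hence `η₁ = near`, `η₂ = far`, and every harmonic function that
vanishes on `X` agrees with some `sol λ α β` at the vertices.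

A digit `1` gives `near λ / far λ = 2 (near (Sλ) / far (Sλ))² - 1`, the duplication formula of
`cosh`. So if `x = e^{-t}` belongs to `S^m λ`, then `x ^ 2 ^ m` belongs to `λ`, and the formulas for
`η₁`, `η₂` follow by induction. The matrices `M₁`, `M₂` become
`N y * D * (N (y ^ 2))⁻¹` with `N y = !![1, -y; -y, 1]` and `D` diagonal, and their products
telescope.
-/

namespace Gasket

/-! ### Geometry of the gasket -/

/-- Barycentric coordinates with respect to the triangle `q₀ q₁ q₂`; the coordinate of index `0` is
the height. -/
noncomputable def bary : Fin 3 → ℝ × ℝ → ℝ :=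
  ![fun p => p.2, fun p => 1 - (√3 * p.1 + p.2) / 2, fun p => (√3 * p.1 - p.2) / 2]

theorem bary_zero (p : ℝ × ℝ) : bary 0 p = p.2 := rfl

theorem bary_one (p : ℝ × ℝ) : bary 1 p = 1 - (√3 * p.1 + p.2) / 2 := rfl

theorem bary_two (p : ℝ × ℝ) : bary 2 p = (√3 * p.1 - p.2) / 2 := rfl

theorem bary_sum (p : ℝ × ℝ) : bary 0 p + bary 1 p + bary 2 p = 1 := by
  rw [bary_zero, bary_one, bary_two]; ring

theorem continuous_bary (i : Fin 3) : Continuous (bary i) := by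
  fin_cases i
  · exact continuous_snd
  · change Continuous fun p : ℝ × ℝ => 1 - (√3 * p.1 + p.2) / 2
    fun_prop
  · change Continuous fun p : ℝ × ℝ => (√3 * p.1 - p.2) / 2
    fun_prop

theorem bary_ext {p p' : ℝ × ℝ} (h : ∀ i, bary i p = bary i p') : p = p' := by
  have h0 := h 0
  have h2 := h 2
  rw [bary_zero, bary_zero] at h0
  rw [bary_two, bary_two] at h2
  have h3 : √3 ≠ 0 := by positivity
  refine Prod.ext (mul_left_cancel₀ h3 ?_) h0
  linarith

theorem bary_q (i j : Fin 3) : bary i (q j) = if i = j then 1 else 0 := by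
  have h3 : √3 ≠ 0 := by positivity
  fin_cases i <;> fin_cases j <;> simp [bary, q] <;> field_simp <;> norm_num

theorem bary_F (i j : Fin 3) (p : ℝ × ℝ) :
    bary i (F j p) = (bary i p + if i = j then 1 else 0) / 2 := by
  rw [← bary_q i j]
  fin_cases i
  · change (F j p).2 = (p.2 + (q j).2) / 2
    simp [F]; ring
  · simp only [Fin.mk_one, bary_one, F, Prod.smul_fst, Prod.smul_snd, Prod.fst_add, Prod.snd_add,
      smul_eq_mul]
    ring
  · change bary 2 _ = (bary 2 _ + bary 2 _) / 2
    simp only [bary_two, F, Prod.smul_fst, Prod.smul_snd, Prod.fst_add, Prod.snd_add,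
      smul_eq_mul]
    ring

theorem F_injective (i : Fin 3) : Function.Injective (F i) := by
  intro p p' h
  have : p + q i = p' + q i := smul_right_injective _ (by norm_num : (1 / 2 : ℝ) ≠ 0) h
  exact add_right_cancel this

/-- The inverse of `F i`. -/
noncomputable def Finv (i : Fin 3) (p : ℝ × ℝ) : ℝ × ℝ := (2 : ℝ) • p - q i

theorem Finv_F (i : Fin 3) (p : ℝ × ℝ) : Finv i (F i p) = p := by
  simp [Finv, F, smul_smul]

theorem continuous_Finv (i : Fin 3) : Continuous (Finv i) := by
  unfold Finv; fun_prop

theorem F_q_comm (i j : Fin 3) : F i (q j) = F j (q i) := by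
  simp [F, add_comm]

theorem eq_q_of_bary_eq_one {p : ℝ × ℝ} (hp : ∀ i, 0 ≤ bary i p) {j : Fin 3}
    (h : bary j p = 1) : p = q j := by
  have hs := bary_sum p
  have h0 := hp 0
  have h1 := hp 1
  have h2 := hp 2
  apply bary_ext
  intro i
  rw [bary_q]
  fin_cases j <;> fin_cases i <;> simp at h ⊢ <;> linarith

theorem isCompact_SG : IsCompact SG := ((SG_spec SG).2 rfl).2.1

theorem F_mem_SG (i : Fin 3) {p : ℝ × ℝ} (hp : p ∈ SG) : F i p ∈ SG := by
  rw [SG_selfSimilar]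
  exact Set.mem_iUnion.2 ⟨i, p, hp, rfl⟩

theorem exists_eq_F {p : ℝ × ℝ} (hp : p ∈ SG) : ∃ j, ∃ p' ∈ SG, p = F j p' := by
  rw [SG_selfSimilar] at hp
  obtain ⟨j, p', hp', rfl⟩ := Set.mem_iUnion.1 hp
  exact ⟨j, p', hp', rfl⟩

theorem V_subset_SG (m : ℕ) : V m ⊆ SG :=
  (Set.subset_iUnion V m).trans subset_closure

theorem q_mem_V (i : Fin 3) (m : ℕ) : q i ∈ V m := by
  induction m with
  | zero => exact ⟨i, rfl⟩
  | succ m ih => exact Set.mem_iUnion.2 ⟨i, q i, ih, F_q i⟩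

theorem q_mem_SG (i : Fin 3) : q i ∈ SG := V_subset_SG 0 (q_mem_V i 0)

theorem F_mem_V (i : Fin 3) {m : ℕ} {p : ℝ × ℝ} (hp : p ∈ V m) : F i p ∈ V (m + 1) :=
  Set.mem_iUnion.2 ⟨i, p, hp, rfl⟩

theorem V_mono : Monotone V := by
  refine monotone_nat_of_le_succ fun m => ?_
  induction m with
  | zero => rintro _ ⟨i, rfl⟩; exact q_mem_V i 1
  | succ m ih => exact Set.iUnion_mono fun i => Set.image_mono ih

theorem finite_V (m : ℕ) : (V m).Finite := by
  induction m with
  | zero => exact Set.finite_range q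
  | succ m ih => exact Set.finite_iUnion fun i => ih.image _

theorem bary_nonneg {p : ℝ × ℝ} (hp : p ∈ SG) (i : Fin 3) : 0 ≤ bary i p := by
  have hcl : IsClosed {p : ℝ × ℝ | ∀ i, 0 ≤ bary i p} := by
    simp only [Set.ofPred_forall]
    exact isClosed_iInter fun i => isClosed_le continuous_const (continuous_bary i)
  have hsub : SG ⊆ {p : ℝ × ℝ | ∀ i, 0 ≤ bary i p} := by
    refine closure_minimal (Set.iUnion_subset fun m => V_subset_of_selfSimilar ⟨q 0, fun i => ?_⟩
      hcl ?_ m) hcl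
    · rw [bary_q]; positivity
    · rintro i _ ⟨p, hp, rfl⟩ j
      rw [bary_F]
      have := hp j
      positivity
  exact hsub hp i

theorem bary_le_one {p : ℝ × ℝ} (hp : p ∈ SG) (i : Fin 3) : bary i p ≤ 1 := by
  have hs := bary_sum p
  have h0 := bary_nonneg hp 0
  have h1 := bary_nonneg hp 1
  have h2 := bary_nonneg hp 2
  fin_cases i <;> simp <;> linarith

theorem height_nonneg {p : ℝ × ℝ} (hp : p ∈ SG) : 0 ≤ p.2 := bary_nonneg hp 0

theorem height_le_one {p : ℝ × ℝ} (hp : p ∈ SG) : p.2 ≤ 1 := bary_le_one hp 0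

theorem height_F_zero (p : ℝ × ℝ) : (F 0 p).2 = (p.2 + 1) / 2 := by
  have := bary_F 0 0 p
  simpa [bary_zero] using this

theorem height_F {j : Fin 3} (hj : j ≠ 0) (p : ℝ × ℝ) : (F j p).2 = p.2 / 2 := by
  have := bary_F 0 j p
  simpa [bary_zero, hj.symm] using this

theorem height_q_zero : (q 0).2 = 1 := by simp [q]

theorem height_q {j : Fin 3} (hj : j ≠ 0) : (q j).2 = 0 := by
  have := bary_q 0 j
  simpa [bary_zero, hj.symm] using this

theorem eq_q_zero_of_height {p : ℝ × ℝ} (hp : p ∈ SG) (h : p.2 = 1) : p = q 0 :=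
  eq_q_of_bary_eq_one (bary_nonneg hp) h

/-- Two different cells of level one meet in their common vertex only. -/
theorem eq_q_of_F_eq_F {p p' : ℝ × ℝ} (hp : p ∈ SG) (hp' : p' ∈ SG) {j k : Fin 3} (hjk : j ≠ k)
    (h : F j p = F k p') : p = q k := by
  have hk : bary k (F j p) = bary k (F k p') := by rw [h]
  rw [bary_F, bary_F, if_neg hjk.symm, if_pos rfl] at hk
  have h1 := bary_nonneg hp' k
  have h2 := bary_le_one hp k
  exact eq_q_of_bary_eq_one (bary_nonneg hp) (by linarith)

theorem mem_V_of_F_mem_V {p : ℝ × ℝ} (hp : p ∈ SG) {j : Fin 3} {m : ℕ}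
    (h : F j p ∈ V (m + 1)) : p ∈ V m := by
  obtain ⟨k, p', hp', hk⟩ := Set.mem_iUnion.1 h
  by_cases hjk : j = k
  · subst hjk
    rwa [← F_injective j hk]
  · rw [eq_q_of_F_eq_F hp (V_subset_SG m hp') hjk hk.symm]
    exact q_mem_V k m

/-! ### Words and cells -/

theorem Fw_cons (i : Fin 3) (w : List (Fin 3)) (p : ℝ × ℝ) : Fw (i :: w) p = F i (Fw w p) := rfl

theorem Fw_mem_SG (w : List (Fin 3)) {p : ℝ × ℝ} (hp : p ∈ SG) : Fw w p ∈ SG := by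
  induction w with
  | nil => exact hp
  | cons i w ih => exact F_mem_SG i ih

theorem Fw_q_mem_V (w : List (Fin 3)) (i : Fin 3) : Fw w (q i) ∈ V w.length := by
  induction w with
  | nil => exact q_mem_V i 0
  | cons j w ih => exact F_mem_V j ih

theorem Fw_replicate (k : ℕ) (i : Fin 3) : Fw (List.replicate k i) = (F i)^[k] := by
  induction k with
  | zero => rfl
  | succ k ih =>
    rw [List.replicate_succ, Function.iterate_succ']
    change F i ∘ Fw _ = _
    rw [ih]

theorem Fw_replicate_q (k : ℕ) (i : Fin 3) : Fw (List.replicate k i) (q i) = q i := by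
  rw [Fw_replicate]
  exact Function.iterate_fixed (F_q i) k

theorem iterate_F_mem_SG (i : Fin 3) (k : ℕ) {p : ℝ × ℝ} (hp : p ∈ SG) : (F i)^[k] p ∈ SG := by
  rw [← Fw_replicate]; exact Fw_mem_SG _ hp

theorem height_Fw (w : List (Fin 3)) (p p' : ℝ × ℝ) :
    (Fw w p).2 - (Fw w p').2 = (p.2 - p'.2) * (1 / 2) ^ w.length := by
  induction w with
  | nil => simp [Fw]
  | cons i w ih =>
    rw [Fw_cons, Fw_cons, List.length_cons, pow_succ, ← mul_assoc, ← ih]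
    by_cases hi : i = 0
    · subst hi; rw [height_F_zero, height_F_zero]; ring
    · rw [height_F hi, height_F hi]; ring

/-- A corner of the gasket is a vertex of only one cell of each level. -/
theorem eq_replicate_of_Fw_eq_q {w : List (Fin 3)} {i j : Fin 3} (h : Fw w (q i) = q j) :
    w = List.replicate w.length j ∧ i = j := by
  induction w with
  | nil =>
    refine ⟨rfl, ?_⟩
    by_contra hij
    have := bary_q i j
    rw [← h] at this
    simp [Fw, bary_q, hij] at this
  | cons k w ih =>
    rw [Fw_cons] at h
    have hk : k = j := by
      by_contra hkj
      have h1 := bary_F j k (Fw w (q i))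
      rw [h, bary_q, if_pos rfl, if_neg (Ne.symm hkj)] at h1
      have := bary_le_one (Fw_mem_SG w (q_mem_SG i)) j
      linarith
    subst hk
    have h2 := ih (F_injective k (h.trans (F_q k).symm))
    refine ⟨?_, h2.2⟩
    rw [List.length_cons, List.replicate_succ, ← h2.1]

/-- A vertex other than the corners belongs to two different cells, in which it has different
positions. -/
theorem exists_two_cells {m : ℕ} {x : ℝ × ℝ} (hx : x ∈ V m) (hx0 : x ∉ V 0) :
    ∃ (w w' : List (Fin 3)) (i i' : Fin 3), w.length = m ∧ w'.length = m ∧ w ≠ w' ∧ i ≠ i' ∧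
      Fw w (q i) = x ∧ Fw w' (q i') = x := by
  induction m generalizing x with
  | zero => exact absurd hx hx0
  | succ m ih =>
    obtain ⟨j, x', hx', rfl⟩ := Set.mem_iUnion.1 hx
    by_cases h : x' ∈ V 0
    · obtain ⟨k, rfl⟩ := h
      have hjk : j ≠ k := by
        rintro rfl
        exact hx0 ⟨j, (F_q j).symm⟩
      refine ⟨j :: List.replicate m k, k :: List.replicate m j, k, j, by simp, by simp, ?_,
        hjk.symm, ?_, ?_⟩
      · simp [hjk]
      · rw [Fw_cons, Fw_replicate_q]
      · rw [Fw_cons, Fw_replicate_q, F_q_comm]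
    · obtain ⟨w, w', i, i', hw, hw', hne, hii, h1, h2⟩ := ih hx' h
      refine ⟨j :: w, j :: w', i, i', by simp [hw], by simp [hw'], by simp [hne], hii, ?_, ?_⟩
      · rw [Fw_cons, h1]
      · rw [Fw_cons, h2]

/-! ### Binary digits and the shift -/

theorem shift_of_lt {lam : ℝ} (h0 : 0 ≤ lam) (h : lam < 1 / 2) : shift lam = 2 * lam :=
  Int.fract_eq_self.2 ⟨by linarith, by linarith⟩

theorem shift_of_ge {lam : ℝ} (h : 1 / 2 ≤ lam) (h1 : lam < 1) : shift lam = 2 * lam - 1 :=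
  Int.fract_eq_iff.2 ⟨by linarith, by linarith, 1, by push_cast; ring⟩

theorem half_le_of_digit_one {lam : ℝ} (h : digit lam 1 = 1) : 1 / 2 ≤ lam := by
  by_contra! hlt
  have : ⌊2 ^ 1 * lam⌋₊ = 0 := Nat.floor_eq_zero.2 (by linarith)
  rw [digit, this] at h
  simp at h

/-- Induction on the number of leading digits `1` of `λ ∈ [0, 1)`. -/
theorem leading_ones_induction {P : ℝ → Prop}
    (zero : ∀ lam, 0 ≤ lam → lam < 1 / 2 → P lam)
    (one : ∀ lam, 1 / 2 ≤ lam → lam < 1 → P (shift lam) → P lam)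
    {lam : ℝ} (h0 : 0 ≤ lam) (h1 : lam < 1) : P lam := by
  have key : ∀ n : ℕ, ∀ lam, 0 ≤ lam → lam < 1 → (1 / 2) ^ n ≤ 1 - lam → P lam := by
    intro n
    induction n with
    | zero =>
      intro lam h0 h1 h
      exact zero lam h0 (by norm_num at h; linarith)
    | succ n ih =>
      intro lam h0 h1 h
      rcases lt_or_ge lam (1 / 2) with hl | hl
      · exact zero lam h0 hl
      · refine one lam hl h1 (ih _ (shift_mem lam).1 (shift_mem lam).2 ?_)
        rw [shift_of_ge hl h1]
        rw [pow_succ] at h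
        linarith
  obtain ⟨n, hn⟩ := exists_pow_lt_of_lt_one (by linarith : 0 < 1 - lam)
    (by norm_num : (1 / 2 : ℝ) < 1)
  exact key n lam h0 h1 hn.le

theorem dyadic_succ_iff {lam : ℝ} (e : ℤ) {mu : ℝ} (hmu : mu = 2 * lam - e) (n : ℕ) :
    (∃ k : ℤ, lam = k * (2 ^ (n + 1))⁻¹) ↔ ∃ k : ℤ, mu = k * (2 ^ n)⁻¹ := by
  constructor
  · rintro ⟨k, hk⟩
    refine ⟨k - e * 2 ^ n, ?_⟩
    rw [hmu, hk]
    push_cast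
    field_simp
    ring
  · rintro ⟨k, hk⟩
    refine ⟨k + e * 2 ^ n, ?_⟩
    have : lam = (mu + e) / 2 := by rw [hmu]; ring
    rw [this, hk]
    push_cast
    field_simp
    ring

theorem dyadic_shift_iff (lam : ℝ) (n : ℕ) :
    (∃ k : ℤ, lam = k * (2 ^ (n + 1))⁻¹) ↔ ∃ k : ℤ, shift lam = k * (2 ^ n)⁻¹ :=
  dyadic_succ_iff ⌊2 * lam⌋ rfl n

theorem isDyadic_shift_iff (lam : ℝ) : IsDyadic (shift lam) ↔ IsDyadic lam := by
  constructor
  · rintro ⟨n, h⟩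
    exact ⟨n + 1, (dyadic_shift_iff lam n).2 h⟩
  · rintro ⟨n, k, h⟩
    refine ⟨n, (dyadic_shift_iff lam n).1 ⟨2 * k, ?_⟩⟩
    rw [h]; push_cast; field_simp; ring

theorem dyadicLevel_zero : dyadicLevel 0 = 0 :=
  Nat.sInf_eq_zero.2 (Or.inl ⟨0, by simp⟩)

theorem dyadicLevel_eq {lam : ℝ} (h0 : 0 < lam) (h1 : lam < 1) (hd : IsDyadic lam) :
    dyadicLevel lam = dyadicLevel (shift lam) + 1 := by
  have hpos : 1 ≤ dyadicLevel lam := by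
    by_contra! h
    have h : dyadicLevel lam = 0 := by omega
    have hmem : dyadicLevel lam ∈ {n : ℕ | ∃ k : ℤ, lam = k * (2 ^ n)⁻¹} := Nat.sInf_mem hd
    rw [h] at hmem
    obtain ⟨k, hk⟩ := hmem
    simp only [pow_zero, inv_one, mul_one] at hk
    rw [hk] at h0 h1
    have h2 : 0 < k := by exact_mod_cast h0
    have h3 : k < 1 := by exact_mod_cast h1
    omega
  have := Nat.sInf_add (p := fun n : ℕ => ∃ k : ℤ, lam = k * (2 ^ n)⁻¹) hpos
  simp only [dyadic_shift_iff] at this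
  exact this.symm

/-! ### Self-similarity of the lower domains -/

theorem mem_OmegaBar {lam : ℝ} (h0 : 0 ≤ lam) (h1 : lam < 1) {p : ℝ × ℝ} :
    p ∈ OmegaBar lam ↔ p ∈ SG ∧ (p.2 < 1 - lam ∨ p ∈ X lam) := by
  constructor
  · rintro (h | h | rfl | rfl)
    · exact ⟨h.1, Or.inl h.2.2⟩
    · exact ⟨h.1, Or.inr h⟩
    · exact ⟨q_mem_SG 1, Or.inl (by rw [height_q (by decide)]; linarith)⟩
    · exact ⟨q_mem_SG 2, Or.inl (by rw [height_q (by decide)]; linarith)⟩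
  · rintro ⟨hp, h | h⟩
    · by_cases hV : p ∈ V 0
      · obtain ⟨i, rfl⟩ := hV
        have hi : i ≠ 0 := by
          rintro rfl
          rw [height_q_zero] at h
          linarith
        right; right
        fin_cases i <;> simp at hi ⊢
      · exact Or.inl ⟨hp, hV, h⟩
    · exact Or.inr (Or.inl h)

theorem OmegaBar_subset_SG {lam : ℝ} (h0 : 0 ≤ lam) (h1 : lam < 1) : OmegaBar lam ⊆ SG :=
  fun _ h => ((mem_OmegaBar h0 h1).1 h).1

theorem height_le_of_mem {lam : ℝ} (h0 : 0 ≤ lam) (h1 : lam < 1) {p : ℝ × ℝ}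
    (hp : p ∈ OmegaBar lam) : p.2 ≤ 1 - lam := by
  rcases ((mem_OmegaBar h0 h1).1 hp).2 with h | h
  · exact h.le
  · exact h.2.1.le

theorem mem_OmegaBar_of_lt {lam : ℝ} (h0 : 0 ≤ lam) (h1 : lam < 1) {p : ℝ × ℝ} (hp : p ∈ SG)
    (h : p.2 < 1 - lam) : p ∈ OmegaBar lam :=
  (mem_OmegaBar h0 h1).2 ⟨hp, Or.inl h⟩

theorem X_subset_OmegaBar (lam : ℝ) : X lam ⊆ OmegaBar lam := fun _ h => Or.inr (Or.inl h)

theorem X_zero : X 0 = {q 0} := by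
  ext p
  constructor
  · rintro ⟨hp, h, -⟩
    exact eq_q_zero_of_height hp (by simpa using h)
  · rintro rfl
    exact ⟨q_mem_SG 0, by simp [height_q_zero], fun _ => q_mem_V 0 _⟩

theorem OmegaBar_zero : OmegaBar 0 = SG := by
  ext p
  rw [mem_OmegaBar le_rfl zero_lt_one]
  refine ⟨fun h => h.1, fun hp => ⟨hp, ?_⟩⟩
  rcases (height_le_one hp).lt_or_eq with h | h
  · exact Or.inl (by linarith)
  · right
    rw [X_zero]
    exact eq_q_zero_of_height hp h

theorem shift_zero : shift 0 = 0 := by simp [shift]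

theorem F_mem_X_iff_of_ge {lam : ℝ} (h : 1 / 2 ≤ lam) (h1 : lam < 1) {j : Fin 3} (hj : j ≠ 0)
    {p : ℝ × ℝ} (hp : p ∈ SG) : F j p ∈ X lam ↔ p ∈ X (shift lam) := by
  have hy : (F j p).2 = 1 - lam ↔ p.2 = 1 - shift lam := by
    rw [height_F hj, shift_of_ge h h1]
    constructor <;> intro <;> linarith
  refine and_congr ⟨fun _ => hp, fun _ => F_mem_SG j hp⟩ (and_congr hy ?_)
  rw [isDyadic_shift_iff]
  refine forall_congr' fun hd => ?_
  rw [dyadicLevel_eq (by linarith) h1 hd]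
  exact ⟨mem_V_of_F_mem_V hp, F_mem_V j⟩

theorem F_mem_X_iff_of_lt {lam : ℝ} (h0 : 0 ≤ lam) (h : lam < 1 / 2)
    {p : ℝ × ℝ} (hp : p ∈ SG) : F 0 p ∈ X lam ↔ p ∈ X (shift lam) := by
  rcases h0.eq_or_lt with rfl | hpos
  · rw [shift_zero, X_zero, Set.mem_singleton_iff, Set.mem_singleton_iff]
    constructor
    · intro h
      exact F_injective 0 (h.trans (F_q 0).symm)
    · rintro rfl
      exact F_q 0
  have hy : (F 0 p).2 = 1 - lam ↔ p.2 = 1 - shift lam := by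
    rw [height_F_zero, shift_of_lt h0 h]
    constructor <;> intro <;> linarith
  refine and_congr ⟨fun _ => hp, fun _ => F_mem_SG 0 hp⟩ (and_congr hy ?_)
  rw [isDyadic_shift_iff]
  refine forall_congr' fun hd => ?_
  rw [dyadicLevel_eq hpos (by linarith) hd]
  exact ⟨mem_V_of_F_mem_V hp, F_mem_V 0⟩

theorem F_mem_OmegaBar_iff_of_ge {lam : ℝ} (h : 1 / 2 ≤ lam) (h1 : lam < 1) {j : Fin 3}
    (hj : j ≠ 0) {p : ℝ × ℝ} (hp : p ∈ SG) : F j p ∈ OmegaBar lam ↔ p ∈ OmegaBar (shift lam) := by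
  rw [mem_OmegaBar (by linarith) h1, mem_OmegaBar (shift_mem lam).1 (shift_mem lam).2,
    F_mem_X_iff_of_ge h h1 hj hp]
  refine and_congr ⟨fun _ => hp, fun _ => F_mem_SG j hp⟩ (or_congr ?_ Iff.rfl)
  rw [height_F hj, shift_of_ge h h1]
  constructor <;> intro <;> linarith

theorem F_mem_OmegaBar_iff_of_lt {lam : ℝ} (h0 : 0 ≤ lam) (h : lam < 1 / 2)
    {p : ℝ × ℝ} (hp : p ∈ SG) : F 0 p ∈ OmegaBar lam ↔ p ∈ OmegaBar (shift lam) := by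
  rw [mem_OmegaBar h0 (by linarith), mem_OmegaBar (shift_mem lam).1 (shift_mem lam).2,
    F_mem_X_iff_of_lt h0 h hp]
  refine and_congr ⟨fun _ => hp, fun _ => F_mem_SG 0 hp⟩ (or_congr ?_ Iff.rfl)
  rw [height_F_zero, shift_of_lt h0 h]
  constructor <;> intro <;> linarith

theorem F_mem_OmegaBar_of_lt {lam : ℝ} (h0 : 0 ≤ lam) (h : lam < 1 / 2) {j : Fin 3} (hj : j ≠ 0)
    {p : ℝ × ℝ} (hp : p ∈ SG) : F j p ∈ OmegaBar lam := by
  refine mem_OmegaBar_of_lt h0 (by linarith) (F_mem_SG j hp) ?_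
  rw [height_F hj]
  have := height_le_one hp
  linarith

/-- If the first digit of `λ` is `1`, the lower domain is the union of two copies of the lower
domain of `Sλ`. -/
theorem exists_of_mem_OmegaBar_of_ge {lam : ℝ} (h : 1 / 2 ≤ lam) (h1 : lam < 1) {p : ℝ × ℝ}
    (hp : p ∈ OmegaBar lam) : ∃ j, j ≠ 0 ∧ ∃ p' ∈ OmegaBar (shift lam), p = F j p' := by
  obtain ⟨j, p', hp', rfl⟩ := exists_eq_F (OmegaBar_subset_SG (by linarith) h1 hp)
  by_cases hj : j = 0
  · subst hj
    -- `F₀ SG` meets the domain only for `λ = 1/2`, in points which are also vertices of `F₁ SG`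
    -- or `F₂ SG`
    have hy := height_le_of_mem (by linarith) h1 hp
    have hy' := height_nonneg hp'
    rw [height_F_zero] at hy
    have hlam : lam = 1 / 2 := by linarith
    have hz : p'.2 = 0 := by linarith
    subst hlam
    have hS : shift (1 / 2) = 0 := by rw [shift_of_ge le_rfl h1]; norm_num
    have hd : IsDyadic (1 / 2) := (isDyadic_shift_iff _).1 (by rw [hS]; exact ⟨0, 0, by simp⟩)
    have hX : F 0 p' ∈ X (1 / 2) := by
      rcases ((mem_OmegaBar (by norm_num) h1).1 hp).2 with h | h
      · rw [height_F_zero, hz] at h; norm_num at h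
      · exact h
    have hV := hX.2.2 hd
    rw [dyadicLevel_eq (by norm_num) h1 hd, hS, dyadicLevel_zero] at hV
    obtain ⟨k, rfl⟩ := mem_V_of_F_mem_V hp' hV
    have hk : k ≠ 0 := by
      rintro rfl
      rw [height_q_zero] at hz
      norm_num at hz
    refine ⟨k, hk, q 0, ?_, F_q_comm _ _⟩
    rw [hS, OmegaBar_zero]
    exact q_mem_SG 0
  · exact ⟨j, hj, p', (F_mem_OmegaBar_iff_of_ge h h1 hj hp').1 hp, rfl⟩

/-- If the first digit of `λ` is `0`, the lower domain consists of a copy of the lower domain of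
`Sλ` and the two lower cells of level one. -/
theorem exists_of_mem_OmegaBar_of_lt {lam : ℝ} (h0 : 0 ≤ lam) (h : lam < 1 / 2) {p : ℝ × ℝ}
    (hp : p ∈ OmegaBar lam) : (∃ p' ∈ OmegaBar (shift lam), p = F 0 p') ∨
      ∃ j, j ≠ 0 ∧ ∃ p' ∈ SG, p = F j p' := by
  obtain ⟨j, p', hp', rfl⟩ := exists_eq_F (OmegaBar_subset_SG h0 (by linarith) hp)
  by_cases hj : j = 0
  · subst hj
    exact Or.inl ⟨p', (F_mem_OmegaBar_iff_of_lt h0 h hp').1 hp, rfl⟩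
  · exact Or.inr ⟨j, hj, p', hp', rfl⟩

theorem exists_of_mem_X_of_ge {lam : ℝ} (h : 1 / 2 ≤ lam) (h1 : lam < 1) {p : ℝ × ℝ}
    (hp : p ∈ X lam) : ∃ j, j ≠ 0 ∧ ∃ p' ∈ X (shift lam), p = F j p' := by
  obtain ⟨j, hj, p', hp', rfl⟩ := exists_of_mem_OmegaBar_of_ge h h1 (X_subset_OmegaBar lam hp)
  exact ⟨j, hj, p', (F_mem_X_iff_of_ge h h1 hj
    (OmegaBar_subset_SG (shift_mem lam).1 (shift_mem lam).2 hp')).1 hp, rfl⟩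

theorem exists_of_mem_X_of_lt {lam : ℝ} (h0 : 0 ≤ lam) (h : lam < 1 / 2) {p : ℝ × ℝ}
    (hp : p ∈ X lam) : ∃ p' ∈ X (shift lam), p = F 0 p' := by
  obtain ⟨j, p', hp', rfl⟩ := exists_eq_F hp.1
  by_cases hj : j = 0
  · subst hj
    exact ⟨p', (F_mem_X_iff_of_lt h0 h hp').1 hp, rfl⟩
  · have h2 := hp.2.1
    rw [height_F hj] at h2
    have := height_le_one hp'
    linarith

theorem isCompact_OmegaBar {lam : ℝ} (h0 : 0 ≤ lam) (h1 : lam < 1) :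
    IsCompact (OmegaBar lam) := by
  by_cases hd : IsDyadic lam
  · obtain ⟨n, hn⟩ := hd
    induction n generalizing lam with
    | zero =>
      obtain ⟨k, hk⟩ := hn
      simp only [pow_zero, inv_one, mul_one] at hk
      have h2 : 0 ≤ k := by rw [hk] at h0; exact_mod_cast h0
      have h3 : k < 1 := by rw [hk] at h1; exact_mod_cast h1
      have : k = 0 := by omega
      rw [hk, this, Int.cast_zero, OmegaBar_zero]
      exact isCompact_SG
    | succ n ih =>
      have hS := ih (shift_mem lam).1 (shift_mem lam).2 ((dyadic_shift_iff lam n).1 hn)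
      have hsub := OmegaBar_subset_SG (shift_mem lam).1 (shift_mem lam).2
      rcases lt_or_ge lam (1 / 2) with hl | hl
      · have : OmegaBar lam = F 0 '' OmegaBar (shift lam) ∪ (F 1 '' SG ∪ F 2 '' SG) := by
          apply Set.Subset.antisymm
          · intro p hp
            rcases exists_of_mem_OmegaBar_of_lt h0 hl hp with ⟨p', hp', rfl⟩ | ⟨j, hj, p', hp', rfl⟩
            · exact Or.inl ⟨p', hp', rfl⟩
            · right
              fin_cases j
              · exact absurd rfl hj
              · exact Or.inl ⟨p', hp', rfl⟩
              · exact Or.inr ⟨p', hp', rfl⟩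
          · rintro _ (⟨p, hp, rfl⟩ | ⟨p, hp, rfl⟩ | ⟨p, hp, rfl⟩)
            · exact (F_mem_OmegaBar_iff_of_lt h0 hl (hsub hp)).2 hp
            · exact F_mem_OmegaBar_of_lt h0 hl (by decide) hp
            · exact F_mem_OmegaBar_of_lt h0 hl (by decide) hp
        rw [this]
        exact (hS.image (continuous_F 0)).union
          ((isCompact_SG.image (continuous_F 1)).union (isCompact_SG.image (continuous_F 2)))
      · have : OmegaBar lam = F 1 '' OmegaBar (shift lam) ∪ F 2 '' OmegaBar (shift lam) := by
          apply Set.Subset.antisymm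
          · intro p hp
            obtain ⟨j, hj, p', hp', rfl⟩ := exists_of_mem_OmegaBar_of_ge hl h1 hp
            fin_cases j
            · exact absurd rfl hj
            · exact Or.inl ⟨p', hp', rfl⟩
            · exact Or.inr ⟨p', hp', rfl⟩
          · rintro _ (⟨p, hp, rfl⟩ | ⟨p, hp, rfl⟩)
            · exact (F_mem_OmegaBar_iff_of_ge hl h1 (by decide) (hsub hp)).2 hp
            · exact (F_mem_OmegaBar_iff_of_ge hl h1 (by decide) (hsub hp)).2 hp
        rw [this]
        exact (hS.image (continuous_F 1)).union (hS.image (continuous_F 2))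
  · have : OmegaBar lam = SG ∩ {p | p.2 ≤ 1 - lam} := by
      ext p
      rw [mem_OmegaBar h0 h1]
      refine and_congr_right fun hp => ?_
      rw [Set.mem_ofPred_eq, le_iff_lt_or_eq]
      exact or_congr Iff.rfl ⟨fun h => h.2.1, fun h => ⟨hp, h, fun hd' => absurd hd' hd⟩⟩
    rw [this]
    exact isCompact_SG.inter_right (isClosed_le continuous_snd continuous_const)

/-! ### The maximum principle -/

theorem cell_subset_OmegaBar {lam : ℝ} (h0 : 0 ≤ lam) (h1 : lam < 1) {w : List (Fin 3)}
    {i : Fin 3} (h : (Fw w (q i)).2 + (1 / 2) ^ w.length < 1 - lam) :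
    Fw w '' SG ⊆ OmegaBar lam := by
  rintro _ ⟨p, hp, rfl⟩
  refine mem_OmegaBar_of_lt h0 h1 (Fw_mem_SG w hp) ?_
  have h2 := height_Fw w p (q i)
  have h3 := height_le_one hp
  have h4 := height_nonneg (q_mem_SG i)
  have h5 : (0 : ℝ) < (1 / 2) ^ w.length := by positivity
  nlinarith

/-- The weak maximum principle. Near `X` the function is small by compactness, so a positive maximum
over `V_m` (for large `m`) is attained away from `X`; the mean value property then passes it on to a
strictly higher neighbour, which is impossible for the highest maximum point. -/
theorem IsHarmonic.nonpos {lam : ℝ} (h0 : 0 ≤ lam) (h1 : lam < 1) {v : ℝ × ℝ → ℝ}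
    (hv : IsHarmonic lam v) (hq1 : v (q 1) ≤ 0) (hq2 : v (q 2) ≤ 0) (hX : ∀ p ∈ X lam, v p ≤ 0)
    {m : ℕ} {x : ℝ × ℝ} (hxV : x ∈ V m) (hx : x ∈ OmegaBar lam) : v x ≤ 0 := by
  by_contra! hpos
  -- the highest point at which `v` is at least `v x` lies strictly below the cut; cells smaller than
  -- its distance from the cut are contained in the domain at all points of this kind
  have hK : IsCompact (OmegaBar lam ∩ v ⁻¹' Set.Ici (v x)) := by
    refine (isCompact_OmegaBar h0 h1).of_isClosed_subset ?_ Set.inter_subset_left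
    exact hv.continuousOn.preimage_isClosed_of_isClosed (isCompact_OmegaBar h0 h1).isClosed
      isClosed_Ici
  obtain ⟨p, ⟨hpO, hpv⟩, hpmax⟩ := hK.exists_isMaxOn ⟨x, hx, le_refl (v x)⟩
    (continuous_snd.continuousOn)
  have hpy : p.2 < 1 - lam := by
    rcases ((mem_OmegaBar h0 h1).1 hpO).2 with h | h
    · exact h
    · exact absurd ((show v x ≤ v p from hpv).trans (hX p h)) (not_le.2 hpos)
  obtain ⟨n, hn⟩ := exists_pow_lt_of_lt_one (by linarith : 0 < 1 - lam - p.2)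
    (by norm_num : (1 / 2 : ℝ) < 1)
  have hnM : (1 / 2 : ℝ) ^ (max m n) ≤ (1 / 2) ^ n :=
    pow_le_pow_of_le_one (by norm_num) (by norm_num) (le_max_right m n)
  set N := max m n
  have hfin : (V N ∩ OmegaBar lam).Finite := (finite_V N).subset Set.inter_subset_left
  have hxS : x ∈ V N ∩ OmegaBar lam := ⟨V_mono (le_max_left m n) hxV, hx⟩
  obtain ⟨a, haS, hamax⟩ := Set.exists_max_image _ v hfin ⟨x, hxS⟩
  obtain ⟨z, ⟨hzS, hza⟩, hzmax⟩ := Set.exists_max_image {z | z ∈ V N ∩ OmegaBar lam ∧ v z = v a}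
    (fun z => z.2) (hfin.subset fun z hz => hz.1) ⟨a, haS, rfl⟩
  have hxz : v x ≤ v z := by rw [hza]; exact hamax x hxS
  have hzp : z.2 ≤ p.2 := hpmax ⟨hzS.2, hxz⟩
  have hz0 : z ∉ V 0 := by
    rintro ⟨i, rfl⟩
    fin_cases i
    · change (q 0).2 ≤ p.2 at hzp
      rw [height_q_zero] at hzp
      linarith
    · exact absurd (hxz.trans hq1) (not_le.2 hpos)
    · exact absurd (hxz.trans hq2) (not_le.2 hpos)
  obtain ⟨w, w', i, i', hw, hw', hne, hii, hwz, hwz'⟩ := exists_two_cells hzS.1 hz0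
  have hcell : ∀ (w : List (Fin 3)) (i : Fin 3), w.length = N → Fw w (q i) = z →
      Fw w '' SG ⊆ OmegaBar lam := by
    intro w i hw hwz
    refine cell_subset_OmegaBar h0 h1 (i := i) ?_
    rw [hwz, hw]
    linarith
  have hc := hcell w i hw hwz
  have hc' := hcell w' i' hw' hwz'
  have hle : ∀ (w : List (Fin 3)), w.length = N → Fw w '' SG ⊆ OmegaBar lam →
      ∀ k, v (Fw w (q k)) ≤ v z := by
    intro w hw hc k
    rw [hza]
    refine hamax _ ⟨?_, hc ⟨q k, q_mem_SG k, rfl⟩⟩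
    rw [← hw]
    exact Fw_q_mem_V w k
  have hmv := hv.mean_value w w' i i' (hw.trans hw'.symm) hne (hwz.trans hwz'.symm) hc hc'
  rw [hwz, hwz'] at hmv
  have h1' := hle w hw hc (i + 1)
  have h2' := hle w hw hc (i + 2)
  have h3' := hle w' hw' hc' (i' + 1)
  have h4' := hle w' hw' hc' (i' + 2)
  -- one of the two cells has its top vertex above `z`, with the same value
  have hup : ∀ (w : List (Fin 3)) (i : Fin 3), w.length = N → Fw w (q i) = z → i ≠ 0 →
      Fw w '' SG ⊆ OmegaBar lam → v (Fw w (q (i + 1))) = v z → v (Fw w (q (i + 2))) = v z →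
      False := by
    intro w i hw hwz hi hc e1 e2
    have e0 : v (Fw w (q 0)) = v z := by
      fin_cases i
      · exact absurd rfl hi
      · exact e2
      · exact e1
    have := hzmax (Fw w (q 0)) ⟨⟨by rw [← hw]; exact Fw_q_mem_V w 0, hc ⟨q 0, q_mem_SG 0, rfl⟩⟩,
      e0.trans hza⟩
    have h2 := height_Fw w (q 0) (q i)
    rw [hwz, height_q_zero, height_q hi] at h2
    have h5 : (0 : ℝ) < (1 / 2) ^ w.length := by positivity
    linarith
  by_cases hi : i = 0
  · exact hup w' i' hw' hwz' (by rw [← hi]; exact hii.symm) hc' (by linarith) (by linarith)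
  · exact hup w i hw hwz hi hc (by linarith) (by linarith)

theorem IsHarmonic.sub {lam : ℝ} {u v : ℝ × ℝ → ℝ} (hu : IsHarmonic lam u)
    (hv : IsHarmonic lam v) : IsHarmonic lam (fun p => u p - v p) where
  continuousOn := hu.continuousOn.sub hv.continuousOn
  mean_value w w' i i' hl hne h hc hc' := by
    have h1 := hu.mean_value w w' i i' hl hne h hc hc'
    have h2 := hv.mean_value w w' i i' hl hne h hc hc'
    linarith

/-- Harmonic functions on the lower domain which have the same boundary values agree at all
vertices. -/
theorem IsHarmonic.eq_of_boundary {lam : ℝ} (h0 : 0 ≤ lam) (h1 : lam < 1) {u v : ℝ × ℝ → ℝ}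
    (hu : IsHarmonic lam u) (hv : IsHarmonic lam v) (hq1 : u (q 1) = v (q 1))
    (hq2 : u (q 2) = v (q 2)) (hX : ∀ p ∈ X lam, u p = v p)
    {m : ℕ} {x : ℝ × ℝ} (hxV : x ∈ V m) (hx : x ∈ OmegaBar lam) : u x = v x := by
  have h2 := (hu.sub hv).nonpos h0 h1 (by simp [hq1]) (by simp [hq2])
    (fun p hp => by simp [hX p hp]) hxV hx
  have h3 := (hv.sub hu).nonpos h0 h1 (by simp [hq1]) (by simp [hq2])
    (fun p hp => by simp [hX p hp]) hxV hx
  linarith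

/-! ### The response of the lower domain to boundary values -/

/-- How the pair of eigenvalues of the Dirichlet-to-Neumann map (with zero values on `X`), for the
boundary values `(1, 1)` and `(1, -1)` at `q₁` and `q₂`, of the lower domain of `λ` is obtained from
the one of `Sλ`: gluing two copies if the first digit is `1`, and putting a copy on top of two cells
if it is `0`. -/
noncomputable def eigStep (lam : ℝ) (z : ℝ × ℝ) : ℝ × ℝ :=
  if lam < 1 / 2 then (5 * z.1 / (3 + 2 * z.1), 5 / 3 * ((3 + 2 * z.2) / (2 + z.2)))
  else (10 / 3 * (z.1 * z.2 / (z.1 + z.2)), 5 / 6 * (z.1 + z.2))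

/-- The approximation of the eigenvalues in which the domain is cut off after `n` digits. For the
full gasket, `λ = 0`, the eigenvalues are `1` and `3`. -/
noncomputable def eigApprox : ℕ → ℝ → ℝ × ℝ
  | 0, _ => (1, 3)
  | n + 1, lam => eigStep lam (eigApprox n (shift lam))

theorem eigStep_mono (lam : ℝ) {z z' : ℝ × ℝ} (h1 : 1 ≤ z.1) (h2 : 1 ≤ z.2) (h : z ≤ z') :
    eigStep lam z ≤ eigStep lam z' := by
  obtain ⟨s, d⟩ := z
  obtain ⟨s', d'⟩ := z'
  obtain ⟨hs, hd⟩ : s ≤ s' ∧ d ≤ d' := h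
  simp only at h1 h2
  unfold eigStep
  split_ifs
  · refine ⟨?_, ?_⟩
    · change 5 * s / (3 + 2 * s) ≤ 5 * s' / (3 + 2 * s')
      rw [div_le_div_iff₀ (by linarith) (by linarith)]
      nlinarith
    · change 5 / 3 * ((3 + 2 * d) / (2 + d)) ≤ 5 / 3 * ((3 + 2 * d') / (2 + d'))
      gcongr ?_ * ?_
      rw [div_le_div_iff₀ (by linarith) (by linarith)]
      nlinarith
  · refine ⟨?_, ?_⟩
    · change 10 / 3 * (s * d / (s + d)) ≤ 10 / 3 * (s' * d' / (s' + d'))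
      gcongr ?_ * ?_
      rw [div_le_div_iff₀ (by linarith) (by linarith)]
      have e1 : s * s' * d ≤ s * s' * d' :=
        mul_le_mul_of_nonneg_left hd (mul_nonneg (by linarith) (by linarith))
      have e2 : d * d' * s ≤ d * d' * s' :=
        mul_le_mul_of_nonneg_left hs (mul_nonneg (by linarith) (by linarith))
      nlinarith
    · change 5 / 6 * (s + d) ≤ 5 / 6 * (s' + d')
      linarith

theorem le_eigStep (lam : ℝ) : ((1, 3) : ℝ × ℝ) ≤ eigStep lam (1, 3) := by
  unfold eigStep
  split_ifs <;> constructor <;> norm_num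

theorem le_eigApprox (n : ℕ) (lam : ℝ) : ((1, 3) : ℝ × ℝ) ≤ eigApprox n lam := by
  induction n generalizing lam with
  | zero => exact le_rfl
  | succ n ih =>
    exact (le_eigStep lam).trans (eigStep_mono lam (by norm_num) (by norm_num) (ih _))

theorem monotone_eigApprox (lam : ℝ) : Monotone fun n => eigApprox n lam := by
  refine monotone_nat_of_le_succ fun n => ?_
  induction n generalizing lam with
  | zero => exact le_eigStep lam
  | succ n ih =>
    have h := le_eigApprox n (shift lam)
    exact eigStep_mono lam h.1 (le_trans (by norm_num) h.2) (ih _)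

theorem eigApprox_bounded {lam : ℝ} (h0 : 0 ≤ lam) (h1 : lam < 1) :
    ∃ C : ℝ, ∀ n, (eigApprox n lam).1 ≤ C ∧ (eigApprox n lam).2 ≤ C := by
  refine leading_ones_induction (P := fun lam => ∃ C : ℝ, ∀ n, (eigApprox n lam).1 ≤ C ∧
    (eigApprox n lam).2 ≤ C) ?_ ?_ h0 h1
  · intro lam _ hl
    refine ⟨10 / 3, fun n => ?_⟩
    cases n with
    | zero => norm_num [eigApprox]
    | succ n =>
      obtain ⟨h2, h3⟩ := le_eigApprox n (shift lam)
      simp only at h2 h3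
      rw [eigApprox, eigStep, if_pos hl]
      constructor
      · change 5 * (eigApprox n (shift lam)).1 / _ ≤ _
        rw [div_le_iff₀ (by linarith)]
        linarith
      · change 5 / 3 * (_ / _) ≤ _
        rw [← mul_div_assoc, div_le_iff₀ (by linarith)]
        linarith
  · rintro lam hl hl1 ⟨C, hC⟩
    refine ⟨max 3 (5 / 3 * C), fun n => ?_⟩
    cases n with
    | zero => norm_num [eigApprox]
    | succ n =>
      obtain ⟨h2, h3⟩ := le_eigApprox n (shift lam)
      obtain ⟨h4, h5⟩ := hC n
      simp only at h2 h3
      rw [eigApprox, eigStep, if_neg (not_lt.2 hl)]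
      constructor
      · refine le_trans ?_ (le_max_right _ _)
        change 10 / 3 * (_ / _) ≤ _
        rw [← mul_div_assoc, div_le_iff₀ (by linarith)]
        nlinarith
      · refine le_trans ?_ (le_max_right _ _)
        change 5 / 6 * (_ + _) ≤ _
        linarith

/-- The eigenvalue of the Dirichlet-to-Neumann map for the boundary values `(1, 1)`. -/
noncomputable def sig (lam : ℝ) : ℝ := ⨆ n, (eigApprox n lam).1

/-- The eigenvalue of the Dirichlet-to-Neumann map for the boundary values `(1, -1)`. -/
noncomputable def del (lam : ℝ) : ℝ := ⨆ n, (eigApprox n lam).2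

theorem tendsto_sig {lam : ℝ} (h0 : 0 ≤ lam) (h1 : lam < 1) :
    Tendsto (fun n => (eigApprox n lam).1) atTop (𝓝 (sig lam)) := by
  obtain ⟨C, hC⟩ := eigApprox_bounded h0 h1
  refine tendsto_atTop_ciSup (fun a b hab => (monotone_eigApprox lam hab).1) ⟨C, ?_⟩
  rintro _ ⟨n, rfl⟩
  exact (hC n).1

theorem tendsto_del {lam : ℝ} (h0 : 0 ≤ lam) (h1 : lam < 1) :
    Tendsto (fun n => (eigApprox n lam).2) atTop (𝓝 (del lam)) := by
  obtain ⟨C, hC⟩ := eigApprox_bounded h0 h1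
  refine tendsto_atTop_ciSup (fun a b hab => (monotone_eigApprox lam hab).2) ⟨C, ?_⟩
  rintro _ ⟨n, rfl⟩
  exact (hC n).2

theorem one_le_sig {lam : ℝ} (h0 : 0 ≤ lam) (h1 : lam < 1) : 1 ≤ sig lam :=
  ge_of_tendsto' (tendsto_sig h0 h1) fun n => (le_eigApprox n lam).1

theorem three_le_del {lam : ℝ} (h0 : 0 ≤ lam) (h1 : lam < 1) : 3 ≤ del lam :=
  ge_of_tendsto' (tendsto_del h0 h1) fun n => (le_eigApprox n lam).2

theorem sig_of_lt {lam : ℝ} (h0 : 0 ≤ lam) (hl : lam < 1 / 2) :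
    sig lam = 5 * sig (shift lam) / (3 + 2 * sig (shift lam)) := by
  obtain ⟨hS0, hS1⟩ := shift_mem lam
  have hs := one_le_sig hS0 hS1
  have h := (tendsto_add_atTop_iff_nat 1).2 (tendsto_sig h0 (by linarith))
  simp only [eigApprox, eigStep, if_pos hl] at h
  have ht := tendsto_sig hS0 hS1
  exact tendsto_nhds_unique h ((ht.const_mul 5).div ((ht.const_mul 2).const_add 3) (by linarith))

theorem del_of_lt {lam : ℝ} (h0 : 0 ≤ lam) (hl : lam < 1 / 2) :
    del lam = 5 / 3 * ((3 + 2 * del (shift lam)) / (2 + del (shift lam))) := by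
  obtain ⟨hS0, hS1⟩ := shift_mem lam
  have hs := three_le_del hS0 hS1
  have h := (tendsto_add_atTop_iff_nat 1).2 (tendsto_del h0 (by linarith))
  simp only [eigApprox, eigStep, if_pos hl] at h
  have ht := tendsto_del hS0 hS1
  exact tendsto_nhds_unique h
    ((((ht.const_mul 2).const_add 3).div (ht.const_add 2) (by linarith)).const_mul _)

theorem sig_of_ge {lam : ℝ} (hl : 1 / 2 ≤ lam) (h1 : lam < 1) :
    sig lam = 10 / 3 *
      (sig (shift lam) * del (shift lam) / (sig (shift lam) + del (shift lam))) := by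
  obtain ⟨hS0, hS1⟩ := shift_mem lam
  have hs := one_le_sig hS0 hS1
  have hd := three_le_del hS0 hS1
  have h := (tendsto_add_atTop_iff_nat 1).2 (tendsto_sig (by linarith) h1)
  simp only [eigApprox, eigStep, if_neg (not_lt.2 hl)] at h
  have ht := tendsto_sig hS0 hS1
  have ht' := tendsto_del hS0 hS1
  exact tendsto_nhds_unique h (((ht.mul ht').div (ht.add ht') (by linarith)).const_mul _)

theorem del_of_ge {lam : ℝ} (hl : 1 / 2 ≤ lam) (h1 : lam < 1) :
    del lam = 5 / 6 * (sig (shift lam) + del (shift lam)) := by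
  obtain ⟨hS0, hS1⟩ := shift_mem lam
  have h := (tendsto_add_atTop_iff_nat 1).2 (tendsto_del (by linarith) h1)
  simp only [eigApprox, eigStep, if_neg (not_lt.2 hl)] at h
  exact tendsto_nhds_unique h (((tendsto_sig hS0 hS1).add (tendsto_del hS0 hS1)).const_mul _)

theorem eigApprox_zero (n : ℕ) : eigApprox n 0 = (1, 3) := by
  induction n with
  | zero => rfl
  | succ n ih =>
    rw [eigApprox, shift_zero, ih, eigStep, if_pos (by norm_num)]
    norm_num

theorem sig_zero : sig 0 = 1 := by simp [sig, eigApprox_zero]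

theorem del_zero : del 0 = 3 := by simp [del, eigApprox_zero]

/-- The two eigenvalues differ: strictness comes from the first digit `0`, and is preserved in front
of it because the harmonic mean is smaller than the arithmetic mean. -/
theorem sig_lt_del {lam : ℝ} (h0 : 0 ≤ lam) (h1 : lam < 1) : sig lam < del lam := by
  refine leading_ones_induction (P := fun lam => sig lam < del lam) ?_ ?_ h0 h1
  · intro lam h0 hl
    obtain ⟨hS0, hS1⟩ := shift_mem lam
    have hs := one_le_sig hS0 hS1
    have hd := three_le_del hS0 hS1
    rw [sig_of_lt h0 hl]
    refine lt_of_lt_of_le ?_ (three_le_del h0 (by linarith))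
    rw [div_lt_iff₀ (by linarith)]
    linarith
  · intro lam hl h1 ih
    obtain ⟨hS0, hS1⟩ := shift_mem lam
    have hs := one_le_sig hS0 hS1
    have hd := three_le_del hS0 hS1
    rw [sig_of_ge hl h1, del_of_ge hl h1, ← mul_div_assoc, div_lt_iff₀ (by linarith)]
    nlinarith [mul_pos (sub_pos.2 ih) (sub_pos.2 ih)]

/-- The normal derivative at `q₁` for the boundary values `1` at `q₁` and `0` at `q₂` and on `X`. -/
noncomputable def near (lam : ℝ) : ℝ := (sig lam + del lam) / 2

/-- Minus the normal derivative at `q₂` for the boundary values `1` at `q₁` and `0` at `q₂` and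
on `X`. -/
noncomputable def far (lam : ℝ) : ℝ := (del lam - sig lam) / 2

theorem far_pos {lam : ℝ} (h0 : 0 ≤ lam) (h1 : lam < 1) : 0 < far lam := by
  have := sig_lt_del h0 h1
  unfold far; linarith

theorem far_lt_near {lam : ℝ} (h0 : 0 ≤ lam) (h1 : lam < 1) : far lam < near lam := by
  have := one_le_sig h0 h1
  unfold far near; linarith

theorem near_zero : near 0 = 2 := by rw [near, sig_zero, del_zero]; norm_num

theorem far_zero : far 0 = 1 := by rw [far, sig_zero, del_zero]; norm_num

theorem near_of_ge {lam : ℝ} (hl : 1 / 2 ≤ lam) (h1 : lam < 1) :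
    near lam = 5 / 3 * (near (shift lam) - far (shift lam) ^ 2 / (2 * near (shift lam))) := by
  obtain ⟨hS0, hS1⟩ := shift_mem lam
  have hs := one_le_sig hS0 hS1
  have hd := three_le_del hS0 hS1
  unfold near far
  rw [sig_of_ge hl h1, del_of_ge hl h1]
  have : sig (shift lam) + del (shift lam) ≠ 0 := by linarith
  field_simp
  ring

theorem far_of_ge {lam : ℝ} (hl : 1 / 2 ≤ lam) (h1 : lam < 1) :
    far lam = 5 / 3 * (far (shift lam) ^ 2 / (2 * near (shift lam))) := by
  obtain ⟨hS0, hS1⟩ := shift_mem lam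
  have hs := one_le_sig hS0 hS1
  have hd := three_le_del hS0 hS1
  unfold near far
  rw [sig_of_ge hl h1, del_of_ge hl h1]
  have : sig (shift lam) + del (shift lam) ≠ 0 := by linarith
  field_simp
  ring

/-- If the first digit of `λ` is `1`: the value at the common vertex of the two copies of the domain
of `Sλ`, for the boundary values `α`, `β` at `q₁`, `q₂`, and `0` on `X`. -/
noncomputable def mid (lam α β : ℝ) : ℝ :=
  far (shift lam) / (2 * near (shift lam)) * (α + β)

/-- The quotient `(u(F₀q₁) + u(F₀q₂)) / (u(q₁) + u(q₂))` if the first digit of `λ` is `0`. -/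
noncomputable def symRatio (lam : ℝ) : ℝ := 3 / (3 + 2 * sig (shift lam))

/-- The quotient `(u(F₀q₁) - u(F₀q₂)) / (u(q₁) - u(q₂))` if the first digit of `λ` is `0`. -/
noncomputable def antiRatio (lam : ℝ) : ℝ := 1 / (2 + del (shift lam))

/-- If the first digit of `λ` is `0`: the value at `F₀q₁`. -/
noncomputable def topL (lam α β : ℝ) : ℝ :=
  (symRatio lam * (α + β) + antiRatio lam * (α - β)) / 2

/-- If the first digit of `λ` is `0`: the value at `F₀q₂`. -/
noncomputable def topR (lam α β : ℝ) : ℝ :=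
  (symRatio lam * (α + β) - antiRatio lam * (α - β)) / 2

/-- If the first digit of `λ` is `0`: the value at `F₁q₂`. -/
noncomputable def bot (lam α β : ℝ) : ℝ := (1 + symRatio lam) * (α + β) / 4

theorem symRatio_bounds (lam : ℝ) : 0 ≤ symRatio lam ∧ symRatio lam ≤ 3 / 5 := by
  obtain ⟨hS0, hS1⟩ := shift_mem lam
  have hs := one_le_sig hS0 hS1
  unfold symRatio
  refine ⟨by positivity, ?_⟩
  rw [div_le_div_iff₀ (by linarith) (by norm_num)]
  linarith

theorem antiRatio_bounds (lam : ℝ) :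
    0 ≤ antiRatio lam ∧ antiRatio lam ≤ 1 / 5 ∧ antiRatio lam ≤ symRatio lam := by
  obtain ⟨hS0, hS1⟩ := shift_mem lam
  have hs := one_le_sig hS0 hS1
  have hd := three_le_del hS0 hS1
  have hsd := sig_lt_del hS0 hS1
  unfold symRatio antiRatio
  refine ⟨by positivity, ?_, ?_⟩
  · rw [div_le_div_iff₀ (by linarith) (by norm_num)]
    linarith
  · rw [div_le_div_iff₀ (by linarith) (by linarith)]
    linarith

theorem symRatio_zero : symRatio 0 = 3 / 5 := by
  rw [symRatio, shift_zero, sig_zero]; norm_num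

theorem antiRatio_zero : antiRatio 0 = 1 / 5 := by
  rw [antiRatio, shift_zero, del_zero]; norm_num

theorem midRatio_bounds (lam : ℝ) : 0 ≤ far (shift lam) / (2 * near (shift lam)) ∧
    far (shift lam) / (2 * near (shift lam)) ≤ 1 / 2 := by
  obtain ⟨hS0, hS1⟩ := shift_mem lam
  have h1 := far_pos hS0 hS1
  have h2 := far_lt_near hS0 hS1
  refine ⟨by have := h1.trans h2; positivity, ?_⟩
  rw [div_le_div_iff₀ (by linarith) (by norm_num)]
  linarith

/-- If `α`, `β` and `0` lie in an interval, so does each of the interpolated values. -/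
theorem linear_comb_mem {lo hi α β c d : ℝ} (hlo : lo ≤ 0) (hhi : 0 ≤ hi)
    (hα : α ∈ Set.Icc lo hi) (hβ : β ∈ Set.Icc lo hi) (hc : 0 ≤ c) (hd : 0 ≤ d)
    (hcd : c + d ≤ 1) : c * α + d * β ∈ Set.Icc lo hi := by
  obtain ⟨h1, h2⟩ := hα
  obtain ⟨h3, h4⟩ := hβ
  have e1 := mul_le_mul_of_nonneg_left h1 hc
  have e2 := mul_le_mul_of_nonneg_left h2 hc
  have e3 := mul_le_mul_of_nonneg_left h3 hd
  have e4 := mul_le_mul_of_nonneg_left h4 hd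
  have e5 := mul_le_mul_of_nonneg_right hcd hhi
  have e6 := mul_le_mul_of_nonpos_right hcd hlo
  constructor <;> linarith

theorem mid_mem {lo hi α β : ℝ} (lam : ℝ) (hlo : lo ≤ 0) (hhi : 0 ≤ hi)
    (hα : α ∈ Set.Icc lo hi) (hβ : β ∈ Set.Icc lo hi) : mid lam α β ∈ Set.Icc lo hi := by
  have h := midRatio_bounds lam
  rw [mid, mul_add]
  exact linear_comb_mem hlo hhi hα hβ h.1 h.1 (by linarith)

theorem topL_mem {lo hi α β : ℝ} (lam : ℝ) (hlo : lo ≤ 0) (hhi : 0 ≤ hi)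
    (hα : α ∈ Set.Icc lo hi) (hβ : β ∈ Set.Icc lo hi) : topL lam α β ∈ Set.Icc lo hi := by
  have h := symRatio_bounds lam
  have h' := antiRatio_bounds lam
  have : topL lam α β = (symRatio lam + antiRatio lam) / 2 * α +
      (symRatio lam - antiRatio lam) / 2 * β := by rw [topL]; ring
  rw [this]
  exact linear_comb_mem hlo hhi hα hβ (by linarith) (by linarith) (by linarith)

theorem topR_mem {lo hi α β : ℝ} (lam : ℝ) (hlo : lo ≤ 0) (hhi : 0 ≤ hi)
    (hα : α ∈ Set.Icc lo hi) (hβ : β ∈ Set.Icc lo hi) : topR lam α β ∈ Set.Icc lo hi := by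
  have h := symRatio_bounds lam
  have h' := antiRatio_bounds lam
  have : topR lam α β = (symRatio lam - antiRatio lam) / 2 * α +
      (symRatio lam + antiRatio lam) / 2 * β := by rw [topR]; ring
  rw [this]
  exact linear_comb_mem hlo hhi hα hβ (by linarith) (by linarith) (by linarith)

theorem bot_mem {lo hi α β : ℝ} (lam : ℝ) (hlo : lo ≤ 0) (hhi : 0 ≤ hi)
    (hα : α ∈ Set.Icc lo hi) (hβ : β ∈ Set.Icc lo hi) : bot lam α β ∈ Set.Icc lo hi := by
  have h := symRatio_bounds lam
  have : bot lam α β = (1 + symRatio lam) / 4 * α + (1 + symRatio lam) / 4 * β := by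
    rw [bot]; ring
  rw [this]
  exact linear_comb_mem hlo hhi hα hβ (by linarith) (by linarith) (by linarith)

theorem abs_mid_le {C α β : ℝ} (lam : ℝ) (hα : |α| ≤ C) (hβ : |β| ≤ C) : |mid lam α β| ≤ C := by
  have hC := (abs_nonneg α).trans hα
  exact abs_le.2 (mid_mem lam (by linarith) hC (abs_le.1 hα) (abs_le.1 hβ))

/-- A digit `0` contracts the values on the copy of the domain of `Sλ`. -/
theorem abs_top_le {C α β : ℝ} (lam : ℝ) (hα : |α| ≤ C) (hβ : |β| ≤ C) :
    |topL lam α β| ≤ 3 / 5 * C ∧ |topR lam α β| ≤ 3 / 5 * C := by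
  have hC := (abs_nonneg α).trans hα
  obtain ⟨h1, h2⟩ := abs_le.1 hα
  obtain ⟨h3, h4⟩ := abs_le.1 hβ
  obtain ⟨h5, h6⟩ := symRatio_bounds lam
  obtain ⟨h7, h8, h9⟩ := antiRatio_bounds lam
  have e1 := mul_nonneg (sub_nonneg.2 h9) (sub_nonneg.2 h2)
  have e2 := mul_nonneg (sub_nonneg.2 h9) (sub_nonneg.2 h4)
  have e3 := mul_nonneg (sub_nonneg.2 h9) (sub_nonneg.2 h1)
  have e4 := mul_nonneg (sub_nonneg.2 h9) (sub_nonneg.2 h3)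
  have f1 := mul_nonneg (add_nonneg h5 h7) (sub_nonneg.2 h2)
  have f2 := mul_nonneg (add_nonneg h5 h7) (sub_nonneg.2 h4)
  have f3 := mul_nonneg (add_nonneg h5 h7) (sub_nonneg.2 h1)
  have f4 := mul_nonneg (add_nonneg h5 h7) (sub_nonneg.2 h3)
  have g := mul_nonneg (sub_nonneg.2 h6) hC
  unfold topL topR
  constructor <;> rw [abs_le] <;> constructor <;> linarith

/-- The differences of the values at the corners of the two lower cells do not exceed the
bound on the boundary values, and are contracted if `λ = 0`. -/
theorem abs_sub_top_le {C α β : ℝ} (lam : ℝ) (hα : |α| ≤ C) (hβ : |β| ≤ C) :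
    (|α - topL lam α β| ≤ C ∧ |bot lam α β - topL lam α β| ≤ C) ∧
      (|bot lam α β - topR lam α β| ≤ C ∧ |β - topR lam α β| ≤ C) := by
  have hC := (abs_nonneg α).trans hα
  obtain ⟨h1, h2⟩ := abs_le.1 hα
  obtain ⟨h3, h4⟩ := abs_le.1 hβ
  obtain ⟨h5, h6⟩ := symRatio_bounds lam
  obtain ⟨h7, h8, h9⟩ := antiRatio_bounds lam
  have e1 := mul_nonneg h7 (sub_nonneg.2 h2)
  have e2 := mul_nonneg h7 (sub_nonneg.2 h4)
  have e3 := mul_nonneg h7 (sub_nonneg.2 h1)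
  have e4 := mul_nonneg h7 (sub_nonneg.2 h3)
  have f1 := mul_nonneg h5 (sub_nonneg.2 h2)
  have f2 := mul_nonneg h5 (sub_nonneg.2 h4)
  have f3 := mul_nonneg h5 (sub_nonneg.2 h1)
  have f4 := mul_nonneg h5 (sub_nonneg.2 h3)
  have g1 := mul_nonneg (sub_nonneg.2 h6) (sub_nonneg.2 h2)
  have g2 := mul_nonneg (sub_nonneg.2 h6) (sub_nonneg.2 h4)
  have g3 := mul_nonneg (sub_nonneg.2 h6) (sub_nonneg.2 h1)
  have g4 := mul_nonneg (sub_nonneg.2 h6) (sub_nonneg.2 h3)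
  have k1 := mul_nonneg (sub_nonneg.2 h8) (sub_nonneg.2 h2)
  have k2 := mul_nonneg (sub_nonneg.2 h8) (sub_nonneg.2 h4)
  have k3 := mul_nonneg (sub_nonneg.2 h8) (sub_nonneg.2 h1)
  have k4 := mul_nonneg (sub_nonneg.2 h8) (sub_nonneg.2 h3)
  have l1 := mul_nonneg (sub_nonneg.2 h9) (sub_nonneg.2 h2)
  have l2 := mul_nonneg (sub_nonneg.2 h9) (sub_nonneg.2 h4)
  have l3 := mul_nonneg (sub_nonneg.2 h9) (sub_nonneg.2 h1)
  have l4 := mul_nonneg (sub_nonneg.2 h9) (sub_nonneg.2 h3)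
  unfold topL topR bot
  refine ⟨⟨?_, ?_⟩, ?_, ?_⟩ <;> rw [abs_le] <;> constructor <;> linarith

theorem abs_sub_top_zero_le {C α β : ℝ} (hα : |α| ≤ C) (hβ : |β| ≤ C) :
    (|α - topL 0 α β| ≤ 4 / 5 * C ∧ |bot 0 α β - topL 0 α β| ≤ 4 / 5 * C) ∧
      (|bot 0 α β - topR 0 α β| ≤ 4 / 5 * C ∧ |β - topR 0 α β| ≤ 4 / 5 * C) := by
  have hC := (abs_nonneg α).trans hα
  obtain ⟨h1, h2⟩ := abs_le.1 hα
  obtain ⟨h3, h4⟩ := abs_le.1 hβ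
  unfold topL topR bot
  rw [symRatio_zero, antiRatio_zero]
  refine ⟨⟨?_, ?_⟩, ?_, ?_⟩ <;> rw [abs_le] <;> constructor <;> linarith

/-- The normal derivatives at the common vertex cancel if the first digit is `1`. -/
theorem mid_balance (lam α β : ℝ) :
    (near (shift lam) * mid lam α β - far (shift lam) * α) +
      (near (shift lam) * mid lam α β - far (shift lam) * β) = 0 := by
  obtain ⟨hS0, hS1⟩ := shift_mem lam
  have h := (far_pos hS0 hS1).trans (far_lt_near hS0 hS1)
  unfold mid
  field_simp
  ring

theorem bot_balance (lam α β : ℝ) :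
    (2 * bot lam α β - α - topL lam α β) + (2 * bot lam α β - β - topR lam α β) = 0 := by
  unfold bot topL topR; ring

theorem topL_balance (lam α β : ℝ) :
    (2 * topL lam α β - α - bot lam α β) +
      (near (shift lam) * topL lam α β - far (shift lam) * topR lam α β) = 0 := by
  obtain ⟨hS0, hS1⟩ := shift_mem lam
  have hs := one_le_sig hS0 hS1
  have hd := three_le_del hS0 hS1
  unfold bot topL topR near far symRatio antiRatio
  have h1 : 3 + 2 * sig (shift lam) ≠ 0 := by linarith
  have h2 : 2 + del (shift lam) ≠ 0 := by linarith
  field_simp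
  ring

theorem topR_balance (lam α β : ℝ) :
    (2 * topR lam α β - β - bot lam α β) +
      (near (shift lam) * topR lam α β - far (shift lam) * topL lam α β) = 0 := by
  obtain ⟨hS0, hS1⟩ := shift_mem lam
  have hs := one_le_sig hS0 hS1
  have hd := three_le_del hS0 hS1
  unfold bot topL topR near far symRatio antiRatio
  have h1 : 3 + 2 * sig (shift lam) ≠ 0 := by linarith
  have h2 : 2 + del (shift lam) ≠ 0 := by linarith
  field_simp
  ring

theorem flux_of_ge {lam : ℝ} (hl : 1 / 2 ≤ lam) (h1 : lam < 1) (α β : ℝ) :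
    5 / 3 * (near (shift lam) * α - far (shift lam) * mid lam α β) =
      near lam * α - far lam * β := by
  rw [near_of_ge hl h1, far_of_ge hl h1, mid]
  ring

theorem flux_of_lt {lam : ℝ} (h0 : 0 ≤ lam) (hl : lam < 1 / 2) (α β : ℝ) :
    5 / 3 * (2 * α - topL lam α β - bot lam α β) = near lam * α - far lam * β := by
  obtain ⟨hS0, hS1⟩ := shift_mem lam
  have hs := one_le_sig hS0 hS1
  have hd := three_le_del hS0 hS1
  unfold near far bot topL symRatio antiRatio
  rw [sig_of_lt h0 hl, del_of_lt h0 hl]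
  have h1 : 3 + 2 * sig (shift lam) ≠ 0 := by linarith
  have h2 : 2 + del (shift lam) ≠ 0 := by linarith
  field_simp
  ring

theorem mid_comm (lam α β : ℝ) : mid lam α β = mid lam β α := by rw [mid, mid, add_comm]

theorem topL_comm (lam α β : ℝ) : topL lam α β = topR lam β α := by rw [topL, topR]; ring

theorem bot_comm (lam α β : ℝ) : bot lam α β = bot lam β α := by rw [bot, bot, add_comm α]

theorem topL_add_topR_zero (α β : ℝ) : topL 0 α β + topR 0 α β = 3 / 5 * (α + β) := by
  rw [topL, topR, symRatio_zero]; ring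

/-! ### Construction of the harmonic functions -/

/-- Approximation, to `n` subdivisions, of the harmonic function with the values `α`, `β` at `q₁`,
`q₂` and `0` on `X`. It starts from the affine function vanishing at `q₀`. A copy of the lower
domain of `Sλ` is filled in recursively, and a full cell by a constant plus the function for
`λ = 0`. -/
noncomputable def solApprox : ℕ → ℝ → ℝ → ℝ → ℝ × ℝ → ℝ
  | 0, _, α, β, p => α * bary 1 p + β * bary 2 p
  | n + 1, lam, α, β, p =>
    if lam < 1 / 2 then
      if 1 / 2 ≤ bary 0 p then
        solApprox n (shift lam) (topL lam α β) (topR lam α β) (Finv 0 p)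
      else if 1 / 2 ≤ bary 1 p then topL lam α β +
        solApprox n 0 (α - topL lam α β) (bot lam α β - topL lam α β) (Finv 1 p)
      else topR lam α β +
        solApprox n 0 (bot lam α β - topR lam α β) (β - topR lam α β) (Finv 2 p)
    else if 1 / 2 ≤ bary 1 p then solApprox n (shift lam) α (mid lam α β) (Finv 1 p)
    else solApprox n (shift lam) (mid lam α β) β (Finv 2 p)

theorem Finv_q (i : Fin 3) : Finv i (q i) = q i := by
  conv_lhs => rw [← F_q i, Finv_F]

theorem solApprox_q_one (n : ℕ) (lam α β : ℝ) : solApprox n lam α β (q 1) = α := by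
  induction n generalizing lam α β with
  | zero => simp [solApprox, bary_q]
  | succ n ih => simp [solApprox, bary_q, Finv_q, ih]; norm_num

theorem solApprox_q_two (n : ℕ) (lam α β : ℝ) : solApprox n lam α β (q 2) = β := by
  induction n generalizing lam α β with
  | zero => simp [solApprox, bary_q]
  | succ n ih => simp [solApprox, bary_q, Finv_q, ih]; norm_num

theorem solApprox_zero_q_zero (n : ℕ) (α β : ℝ) : solApprox n 0 α β (q 0) = 0 := by
  induction n generalizing α β with
  | zero => simp [solApprox, bary_q]
  | succ n ih =>
    simp only [solApprox, bary_q, Finv_q, shift_zero, ih]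
    norm_num

theorem bary_F_self_ge {p : ℝ × ℝ} (hp : p ∈ SG) (i : Fin 3) : 1 / 2 ≤ bary i (F i p) := by
  rw [bary_F, if_pos rfl]
  have := bary_nonneg hp i
  linarith

theorem eq_q_of_half_le_bary {p : ℝ × ℝ} (hp : p ∈ SG) {i j : Fin 3} (hij : i ≠ j)
    (h : 1 / 2 ≤ bary i (F j p)) : p = q i := by
  rw [bary_F, if_neg hij] at h
  have := bary_le_one hp i
  exact eq_q_of_bary_eq_one (bary_nonneg hp) (by linarith)

section Subdivision

variable {lam : ℝ} (n : ℕ) (α β : ℝ) {p : ℝ × ℝ}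

theorem solApprox_F_one_of_ge (hl : 1 / 2 ≤ lam) (hp : p ∈ SG) :
    solApprox (n + 1) lam α β (F 1 p) = solApprox n (shift lam) α (mid lam α β) p := by
  rw [solApprox, if_neg (not_lt.2 hl), if_pos (bary_F_self_ge hp 1), Finv_F]

theorem solApprox_F_two_of_ge (hl : 1 / 2 ≤ lam) (hp : p ∈ SG) :
    solApprox (n + 1) lam α β (F 2 p) = solApprox n (shift lam) (mid lam α β) β p := by
  rw [solApprox, if_neg (not_lt.2 hl)]
  split_ifs with h
  · rw [eq_q_of_half_le_bary hp (by decide) h, F_q_comm, Finv_F, solApprox_q_one,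
      solApprox_q_two]
  · rw [Finv_F]

theorem solApprox_F_zero_of_lt (hl : lam < 1 / 2) (hp : p ∈ SG) :
    solApprox (n + 1) lam α β (F 0 p) =
      solApprox n (shift lam) (topL lam α β) (topR lam α β) p := by
  rw [solApprox, if_pos hl, if_pos (bary_F_self_ge hp 0), Finv_F]

theorem solApprox_F_one_of_lt (hl : lam < 1 / 2) (hp : p ∈ SG) :
    solApprox (n + 1) lam α β (F 1 p) = topL lam α β +
      solApprox n 0 (α - topL lam α β) (bot lam α β - topL lam α β) p := by
  rw [solApprox, if_pos hl]
  split_ifs with h h'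
  · rw [eq_q_of_half_le_bary hp (by decide) h, F_q_comm, Finv_F, solApprox_q_one,
      solApprox_zero_q_zero, add_zero]
  · rw [Finv_F]
  · exact absurd (bary_F_self_ge hp 1) h'

theorem solApprox_F_two_of_lt (hl : lam < 1 / 2) (hp : p ∈ SG) :
    solApprox (n + 1) lam α β (F 2 p) = topR lam α β +
      solApprox n 0 (bot lam α β - topR lam α β) (β - topR lam α β) p := by
  rw [solApprox, if_pos hl]
  split_ifs with h h'
  · rw [eq_q_of_half_le_bary hp (by decide) h, F_q_comm, Finv_F, solApprox_q_two,
      solApprox_zero_q_zero, add_zero]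
  · rw [eq_q_of_half_le_bary hp (by decide) h', F_q_comm, Finv_F, solApprox_q_two,
      solApprox_q_one]
    ring
  · rw [Finv_F]

end Subdivision

/-- Case distinction along the subdivision of the lower domain into copies of that of `Sλ` and full
cells. -/
theorem OmegaBar_cases {lam : ℝ} (h0 : 0 ≤ lam) (h1 : lam < 1) {P : ℝ × ℝ → Prop}
    (ge₁ : 1 / 2 ≤ lam → ∀ p ∈ OmegaBar (shift lam), p ∈ SG → P (F 1 p))
    (ge₂ : 1 / 2 ≤ lam → ∀ p ∈ OmegaBar (shift lam), p ∈ SG → P (F 2 p))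
    (lt₀ : lam < 1 / 2 → ∀ p ∈ OmegaBar (shift lam), p ∈ SG → P (F 0 p))
    (lt₁ : lam < 1 / 2 → ∀ p ∈ SG, P (F 1 p)) (lt₂ : lam < 1 / 2 → ∀ p ∈ SG, P (F 2 p))
    {p : ℝ × ℝ} (hp : p ∈ OmegaBar lam) : P p := by
  have hsub := OmegaBar_subset_SG (shift_mem lam).1 (shift_mem lam).2
  rcases lt_or_ge lam (1 / 2) with hl | hl
  · rcases exists_of_mem_OmegaBar_of_lt h0 hl hp with ⟨p', hp', rfl⟩ | ⟨j, hj, p', hp', rfl⟩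
    · exact lt₀ hl p' hp' (hsub hp')
    · fin_cases j
      · exact absurd rfl hj
      · exact lt₁ hl p' hp'
      · exact lt₂ hl p' hp'
  · obtain ⟨j, hj, p', hp', rfl⟩ := exists_of_mem_OmegaBar_of_ge hl h1 hp
    fin_cases j
    · exact absurd rfl hj
    · exact ge₁ hl p' hp' (hsub hp')
    · exact ge₂ hl p' hp' (hsub hp')

theorem sub_mem_Icc_sub {lo hi a c : ℝ} (h : a ∈ Set.Icc lo hi) :
    a - c ∈ Set.Icc (lo - c) (hi - c) :=
  ⟨sub_le_sub_right h.1 c, sub_le_sub_right h.2 c⟩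

theorem add_mem_Icc_of_sub {lo hi a c : ℝ} (h : a ∈ Set.Icc (lo - c) (hi - c)) :
    c + a ∈ Set.Icc lo hi :=
  ⟨by linarith [h.1], by linarith [h.2]⟩

/-- The values lie in every interval that contains `α`, `β` and `0`. Intervals rather than bounds on
the absolute value are needed for the cells on which a constant is added. -/
theorem solApprox_mem {lo hi : ℝ} (n : ℕ) {lam α β : ℝ} (h0 : 0 ≤ lam) (h1 : lam < 1)
    (hlo : lo ≤ 0) (hhi : 0 ≤ hi) (hα : α ∈ Set.Icc lo hi) (hβ : β ∈ Set.Icc lo hi) {p : ℝ × ℝ}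
    (hp : p ∈ OmegaBar lam) : solApprox n lam α β p ∈ Set.Icc lo hi := by
  induction n generalizing lam α β lo hi p with
  | zero =>
    have hpS := OmegaBar_subset_SG h0 h1 hp
    have hb := bary_sum p
    have hb0 := bary_nonneg hpS 0
    have := linear_comb_mem hlo hhi hα hβ (bary_nonneg hpS 1) (bary_nonneg hpS 2) (by linarith)
    rwa [mul_comm, mul_comm (bary 2 p)] at this
  | succ n ih =>
    obtain ⟨hS0, hS1⟩ := shift_mem lam
    have hm := mid_mem lam hlo hhi hα hβ
    have hL := topL_mem lam hlo hhi hα hβ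
    have hR := topR_mem lam hlo hhi hα hβ
    have hB := bot_mem lam hlo hhi hα hβ
    refine OmegaBar_cases (P := fun p => solApprox (n + 1) lam α β p ∈ Set.Icc lo hi) h0 h1
      ?_ ?_ ?_ ?_ ?_ hp
    · intro hl p hp hpS
      rw [solApprox_F_one_of_ge n α β hl hpS]
      exact ih hS0 hS1 hlo hhi hα hm hp
    · intro hl p hp hpS
      rw [solApprox_F_two_of_ge n α β hl hpS]
      exact ih hS0 hS1 hlo hhi hm hβ hp
    · intro hl p hp hpS
      rw [solApprox_F_zero_of_lt n α β hl hpS]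
      exact ih hS0 hS1 hlo hhi hL hR hp
    · intro hl p hpS
      rw [solApprox_F_one_of_lt n α β hl hpS]
      exact add_mem_Icc_of_sub (ih le_rfl zero_lt_one (sub_nonpos.2 hL.1) (sub_nonneg.2 hL.2)
        (sub_mem_Icc_sub hα) (sub_mem_Icc_sub hB) (by rwa [OmegaBar_zero]))
    · intro hl p hpS
      rw [solApprox_F_two_of_lt n α β hl hpS]
      exact add_mem_Icc_of_sub (ih le_rfl zero_lt_one (sub_nonpos.2 hR.1) (sub_nonneg.2 hR.2)
        (sub_mem_Icc_sub hB) (sub_mem_Icc_sub hβ) (by rwa [OmegaBar_zero]))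

theorem abs_solApprox_le (n : ℕ) {lam α β C : ℝ} (h0 : 0 ≤ lam) (h1 : lam < 1)
    (hα : |α| ≤ C) (hβ : |β| ≤ C) {p : ℝ × ℝ} (hp : p ∈ OmegaBar lam) :
    |solApprox n lam α β p| ≤ C := by
  have hC := (abs_nonneg α).trans hα
  exact abs_le.2 (solApprox_mem n h0 h1 (by linarith) hC (abs_le.1 hα) (abs_le.1 hβ) hp)

theorem abs_solApprox_sub_le (n n' : ℕ) {lam α β C : ℝ} (h0 : 0 ≤ lam) (h1 : lam < 1)
    (hα : |α| ≤ C) (hβ : |β| ≤ C) {p : ℝ × ℝ} (hp : p ∈ OmegaBar lam) :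
    |solApprox n lam α β p - solApprox n' lam α β p| ≤ 2 * C := by
  have h2 := abs_solApprox_le n h0 h1 hα hβ hp
  have h3 := abs_solApprox_le n' h0 h1 hα hβ hp
  exact (abs_sub _ _).trans (by linarith)

/-- On the full gasket every subdivision contracts. -/
theorem solApprox_zero_cauchy (k : ℕ) {n n' : ℕ} (hn : k ≤ n) (hn' : k ≤ n') {α β C : ℝ}
    (hα : |α| ≤ C) (hβ : |β| ≤ C) {p : ℝ × ℝ} (hp : p ∈ SG) :
    |solApprox n 0 α β p - solApprox n' 0 α β p| ≤ 2 * C * (4 / 5) ^ k := by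
  induction k generalizing n n' α β C p with
  | zero =>
    rw [pow_zero, mul_one]
    exact abs_solApprox_sub_le n n' le_rfl zero_lt_one hα hβ (by rwa [OmegaBar_zero])
  | succ k ih =>
    obtain ⟨n, rfl⟩ := Nat.exists_eq_add_of_le' (le_trans (by omega) hn : 1 ≤ n)
    obtain ⟨n', rfl⟩ := Nat.exists_eq_add_of_le' (le_trans (by omega) hn' : 1 ≤ n')
    have hn : k ≤ n := by omega
    have hn' : k ≤ n' := by omega
    have hC := (abs_nonneg α).trans hα
    have hl : (0 : ℝ) < 1 / 2 := by norm_num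
    have e : 2 * C * (4 / 5 : ℝ) ^ (k + 1) = 2 * (4 / 5 * C) * (4 / 5) ^ k := by ring
    obtain ⟨t1, t2⟩ := abs_top_le 0 hα hβ
    obtain ⟨⟨t3, t4⟩, t5, t6⟩ := abs_sub_top_zero_le hα hβ
    rw [e]
    obtain ⟨j, p', hp', rfl⟩ := exists_eq_F hp
    fin_cases j
    · simp only [Fin.zero_eta]
      rw [solApprox_F_zero_of_lt n α β hl hp', solApprox_F_zero_of_lt n' α β hl hp', shift_zero]
      exact ih hn hn' (t1.trans (by linarith)) (t2.trans (by linarith)) hp'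
    · simp only [Fin.mk_one]
      rw [solApprox_F_one_of_lt n α β hl hp', solApprox_F_one_of_lt n' α β hl hp',
        add_sub_add_left_eq_sub]
      exact ih hn hn' t3 t4 hp'
    · simp only [Fin.reduceFinMk]
      rw [solApprox_F_two_of_lt n α β hl hp', solApprox_F_two_of_lt n' α β hl hp',
        add_sub_add_left_eq_sub]
      exact ih hn hn' t5 t6 hp'

/-- The approximations are uniformly Cauchy. Only the digits `0` give a contraction, so the number of
subdivisions needed depends on `λ`. The constant `5 / 2 = 2 * (5 / 4)` leaves room for the two lower
cells, on which the first subdivision need not contract. -/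
theorem solApprox_cauchy (k : ℕ) {lam : ℝ} (h0 : 0 ≤ lam) (h1 : lam < 1) :
    ∃ n₀, ∀ n ≥ n₀, ∀ n' ≥ n₀, ∀ α β C : ℝ, |α| ≤ C → |β| ≤ C → ∀ p ∈ OmegaBar lam,
      |solApprox n lam α β p - solApprox n' lam α β p| ≤ 5 / 2 * C * (4 / 5) ^ k := by
  induction k generalizing lam with
  | zero =>
    refine ⟨0, fun n _ n' _ α β C hα hβ p hp => ?_⟩
    have hC := (abs_nonneg α).trans hα
    exact (abs_solApprox_sub_le n n' h0 h1 hα hβ hp).trans (by linarith)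
  | succ k ih =>
    refine leading_ones_induction (P := fun lam => ∃ n₀, ∀ n ≥ n₀, ∀ n' ≥ n₀, ∀ α β C : ℝ,
      |α| ≤ C → |β| ≤ C → ∀ p ∈ OmegaBar lam,
      |solApprox n lam α β p - solApprox n' lam α β p| ≤ 5 / 2 * C * (4 / 5) ^ (k + 1)) ?_ ?_ h0 h1
    · intro lam h0 hl
      obtain ⟨n₀, hn₀⟩ := ih (shift_mem lam).1 (shift_mem lam).2
      -- the lower cells are full gaskets, where `k` further subdivisions contract by `(4 / 5) ^ k`
      refine ⟨max n₀ k + 1, fun n hn n' hn' α β C hα hβ p hp => ?_⟩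
      obtain ⟨n, rfl⟩ := Nat.exists_eq_add_of_le' (le_trans (by omega) hn : 1 ≤ n)
      obtain ⟨n', rfl⟩ := Nat.exists_eq_add_of_le' (le_trans (by omega) hn' : 1 ≤ n')
      have hC := (abs_nonneg α).trans hα
      obtain ⟨t1, t2⟩ := abs_top_le lam hα hβ
      obtain ⟨⟨t3, t4⟩, t5, t6⟩ := abs_sub_top_le lam hα hβ
      have e : 5 / 2 * C * (4 / 5 : ℝ) ^ (k + 1) = 2 * C * (4 / 5) ^ k := by ring
      have e' : 5 / 2 * C * (4 / 5 : ℝ) ^ (k + 1) = 5 / 2 * (4 / 5 * C) * (4 / 5) ^ k := by ring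
      refine OmegaBar_cases (P := fun p => |solApprox (n + 1) lam α β p -
        solApprox (n' + 1) lam α β p| ≤ 5 / 2 * C * (4 / 5) ^ (k + 1)) h0 (by linarith)
        (fun h => absurd hl (not_lt.2 h)) (fun h => absurd hl (not_lt.2 h)) ?_ ?_ ?_ hp
      · intro hl p hp hpS
        rw [solApprox_F_zero_of_lt n α β hl hpS, solApprox_F_zero_of_lt n' α β hl hpS, e']
        exact hn₀ n (by omega) n' (by omega) _ _ _ (t1.trans (by linarith))
          (t2.trans (by linarith)) p hp
      · intro hl p hpS
        rw [solApprox_F_one_of_lt n α β hl hpS, solApprox_F_one_of_lt n' α β hl hpS,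
          add_sub_add_left_eq_sub, e]
        exact solApprox_zero_cauchy k (by omega) (by omega) t3 t4 hpS
      · intro hl p hpS
        rw [solApprox_F_two_of_lt n α β hl hpS, solApprox_F_two_of_lt n' α β hl hpS,
          add_sub_add_left_eq_sub, e]
        exact solApprox_zero_cauchy k (by omega) (by omega) t5 t6 hpS
    · rintro lam hl h1 ⟨n₀, hn₀⟩
      refine ⟨n₀ + 1, fun n hn n' hn' α β C hα hβ p hp => ?_⟩
      obtain ⟨n, rfl⟩ := Nat.exists_eq_add_of_le' (le_trans (by omega) hn : 1 ≤ n)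
      obtain ⟨n', rfl⟩ := Nat.exists_eq_add_of_le' (le_trans (by omega) hn' : 1 ≤ n')
      have hm := abs_mid_le lam hα hβ
      refine OmegaBar_cases (P := fun p => |solApprox (n + 1) lam α β p -
        solApprox (n' + 1) lam α β p| ≤ 5 / 2 * C * (4 / 5) ^ (k + 1)) (by linarith) h1
        ?_ ?_ (fun h => absurd h (not_lt.2 hl)) (fun h => absurd h (not_lt.2 hl))
        (fun h => absurd h (not_lt.2 hl)) hp
      · intro hl p hp hpS
        rw [solApprox_F_one_of_ge n α β hl hpS, solApprox_F_one_of_ge n' α β hl hpS]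
        exact hn₀ n (by omega) n' (by omega) _ _ _ hα hm p hp
      · intro hl p hp hpS
        rw [solApprox_F_two_of_ge n α β hl hpS, solApprox_F_two_of_ge n' α β hl hpS]
        exact hn₀ n (by omega) n' (by omega) _ _ _ hm hβ p hp

theorem continuousOn_image_F {f : ℝ × ℝ → ℝ} {K : Set (ℝ × ℝ)} (j : Fin 3)
    (h : ContinuousOn (fun p => f (F j p)) K) : ContinuousOn f (F j '' K) := by
  have h2 : ContinuousOn (fun p => f (F j (Finv j p))) (F j '' K) := by
    refine ContinuousOn.comp (g := fun p => f (F j p)) h (continuous_Finv j).continuousOn ?_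
    rintro _ ⟨p, hp, rfl⟩
    rwa [Finv_F]
  refine h2.congr ?_
  rintro _ ⟨p, hp, rfl⟩
  simp only [Finv_F]

theorem continuousOn_solApprox (n : ℕ) {lam : ℝ} (h0 : 0 ≤ lam) (h1 : lam < 1) (α β : ℝ) :
    ContinuousOn (solApprox n lam α β) (OmegaBar lam) := by
  induction n generalizing lam α β with
  | zero =>
    exact ((continuous_const.mul (continuous_bary 1)).add
      (continuous_const.mul (continuous_bary 2))).continuousOn
  | succ n ih =>
    obtain ⟨hS0, hS1⟩ := shift_mem lam
    have hsub := OmegaBar_subset_SG hS0 hS1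
    have hcS := isCompact_OmegaBar hS0 hS1
    have hcl : ∀ {K : Set (ℝ × ℝ)} (j : Fin 3), IsCompact K → IsClosed (F j '' K) :=
      fun j hK => (hK.image (continuous_F j)).isClosed
    have ih0 := fun α β => ih le_rfl zero_lt_one α β
    rw [OmegaBar_zero] at ih0
    rcases lt_or_ge lam (1 / 2) with hl | hl
    · refine ContinuousOn.mono (s := F 0 '' OmegaBar (shift lam) ∪ (F 1 '' SG ∪ F 2 '' SG)) ?_ ?_
      · refine ContinuousOn.union_of_isClosed (continuousOn_image_F 0 ?_)
          (ContinuousOn.union_of_isClosed (continuousOn_image_F 1 ?_) (continuousOn_image_F 2 ?_)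
            (hcl 1 isCompact_SG) (hcl 2 isCompact_SG)) (hcl 0 hcS)
          ((hcl 1 isCompact_SG).union (hcl 2 isCompact_SG))
        · exact (ih hS0 hS1 _ _).congr fun p hp => solApprox_F_zero_of_lt n α β hl (hsub hp)
        · exact (continuousOn_const.add (ih0 _ _)).congr fun p hp =>
            solApprox_F_one_of_lt n α β hl hp
        · exact (continuousOn_const.add (ih0 _ _)).congr fun p hp =>
            solApprox_F_two_of_lt n α β hl hp
      · intro p hp
        exact OmegaBar_cases (P := fun p => p ∈ F 0 '' OmegaBar (shift lam) ∪
            (F 1 '' SG ∪ F 2 '' SG)) h0 h1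
          (fun h => absurd hl (not_lt.2 h)) (fun h => absurd hl (not_lt.2 h))
          (fun _ p hp _ => Or.inl ⟨p, hp, rfl⟩) (fun _ p hp => Or.inr (Or.inl ⟨p, hp, rfl⟩))
          (fun _ p hp => Or.inr (Or.inr ⟨p, hp, rfl⟩)) hp
    · refine ContinuousOn.mono
        (s := F 1 '' OmegaBar (shift lam) ∪ F 2 '' OmegaBar (shift lam)) ?_ ?_
      · refine ContinuousOn.union_of_isClosed (continuousOn_image_F 1 ?_)
          (continuousOn_image_F 2 ?_) (hcl 1 hcS) (hcl 2 hcS)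
        · exact (ih hS0 hS1 _ _).congr fun p hp => solApprox_F_one_of_ge n α β hl (hsub hp)
        · exact (ih hS0 hS1 _ _).congr fun p hp => solApprox_F_two_of_ge n α β hl (hsub hp)
      · intro p hp
        exact OmegaBar_cases (P := fun p => p ∈ F 1 '' OmegaBar (shift lam) ∪
            F 2 '' OmegaBar (shift lam)) h0 h1
          (fun _ p hp _ => Or.inl ⟨p, hp, rfl⟩) (fun _ p hp _ => Or.inr ⟨p, hp, rfl⟩)
          (fun h => absurd h (not_lt.2 hl)) (fun h => absurd h (not_lt.2 hl))
          (fun h => absurd h (not_lt.2 hl)) hp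

/-- The harmonic function on the lower domain with the values `α`, `β` at `q₁`, `q₂` and `0`
on `X`. -/
noncomputable def sol (lam α β : ℝ) (p : ℝ × ℝ) : ℝ :=
  limUnder atTop fun n => solApprox n lam α β p

theorem tendsto_zero_of_contraction (C : ℝ) {r : ℝ} (h0 : 0 ≤ r) (h1 : r < 1) :
    Tendsto (fun k : ℕ => C * r ^ k) atTop (𝓝 0) := by
  simpa using (tendsto_pow_atTop_nhds_zero_of_lt_one h0 h1).const_mul C

theorem tendsto_solApprox {lam : ℝ} (h0 : 0 ≤ lam) (h1 : lam < 1) (α β : ℝ) {p : ℝ × ℝ}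
    (hp : p ∈ OmegaBar lam) :
    Tendsto (fun n => solApprox n lam α β p) atTop (𝓝 (sol lam α β p)) := by
  refine CauchySeq.tendsto_limUnder (Metric.cauchySeq_iff.2 fun ε hε => ?_)
  obtain ⟨k, hk⟩ := ((tendsto_zero_of_contraction (5 / 2 * max |α| |β|)
    (by norm_num : (0 : ℝ) ≤ 4 / 5) (by norm_num)).eventually (gt_mem_nhds hε)).exists
  obtain ⟨n₀, hn₀⟩ := solApprox_cauchy k h0 h1
  refine ⟨n₀, fun n hn n' hn' => ?_⟩
  exact (hn₀ n hn n' hn' α β _ (le_max_left _ _) (le_max_right _ _) p hp).trans_lt hk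

theorem continuousOn_sol {lam : ℝ} (h0 : 0 ≤ lam) (h1 : lam < 1) (α β : ℝ) :
    ContinuousOn (sol lam α β) (OmegaBar lam) := by
  have hunif : TendstoUniformlyOn (fun n => solApprox n lam α β) (sol lam α β) atTop
      (OmegaBar lam) := by
    refine Metric.tendstoUniformlyOn_iff.2 fun ε hε => ?_
    obtain ⟨k, hk⟩ := ((tendsto_zero_of_contraction (5 / 2 * max |α| |β|)
      (by norm_num : (0 : ℝ) ≤ 4 / 5) (by norm_num)).eventually (gt_mem_nhds hε)).exists
    obtain ⟨n₀, hn₀⟩ := solApprox_cauchy k h0 h1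
    filter_upwards [eventually_ge_atTop n₀] with n hn p hp
    refine lt_of_le_of_lt ?_ hk
    refine le_of_tendsto ((tendsto_solApprox h0 h1 α β hp).dist tendsto_const_nhds) ?_
    filter_upwards [eventually_ge_atTop n₀] with n' hn'
    exact hn₀ n' hn' n hn α β _ (le_max_left _ _) (le_max_right _ _) p hp
  exact hunif.continuousOn (Frequently.of_forall fun n => continuousOn_solApprox n h0 h1 α β)

theorem sol_q_one (lam α β : ℝ) : sol lam α β (q 1) = α := by
  simp only [sol, solApprox_q_one]
  exact tendsto_const_nhds.limUnder_eq

theorem sol_q_two (lam α β : ℝ) : sol lam α β (q 2) = β := by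
  simp only [sol, solApprox_q_two]
  exact tendsto_const_nhds.limUnder_eq

theorem sol_zero_q_zero (α β : ℝ) : sol 0 α β (q 0) = 0 := by
  simp only [sol, solApprox_zero_q_zero]
  exact tendsto_const_nhds.limUnder_eq

section Subdivision

variable {lam : ℝ} (α β : ℝ) {p : ℝ × ℝ}

theorem sol_F_one_of_ge (hl : 1 / 2 ≤ lam) (h1 : lam < 1) (hp : p ∈ OmegaBar (shift lam)) :
    sol lam α β (F 1 p) = sol (shift lam) α (mid lam α β) p := by
  obtain ⟨hS0, hS1⟩ := shift_mem lam
  have hpS := OmegaBar_subset_SG hS0 hS1 hp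
  have h := (tendsto_add_atTop_iff_nat 1).2 (tendsto_solApprox (by linarith) h1 α β
    ((F_mem_OmegaBar_iff_of_ge hl h1 (by decide : (1 : Fin 3) ≠ 0) hpS).2 hp))
  simp only [solApprox_F_one_of_ge _ α β hl hpS] at h
  exact tendsto_nhds_unique h (tendsto_solApprox hS0 hS1 _ _ hp)

theorem sol_F_two_of_ge (hl : 1 / 2 ≤ lam) (h1 : lam < 1) (hp : p ∈ OmegaBar (shift lam)) :
    sol lam α β (F 2 p) = sol (shift lam) (mid lam α β) β p := by
  obtain ⟨hS0, hS1⟩ := shift_mem lam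
  have hpS := OmegaBar_subset_SG hS0 hS1 hp
  have h := (tendsto_add_atTop_iff_nat 1).2 (tendsto_solApprox (by linarith) h1 α β
    ((F_mem_OmegaBar_iff_of_ge hl h1 (by decide : (2 : Fin 3) ≠ 0) hpS).2 hp))
  simp only [solApprox_F_two_of_ge _ α β hl hpS] at h
  exact tendsto_nhds_unique h (tendsto_solApprox hS0 hS1 _ _ hp)

theorem sol_F_zero_of_lt (h0 : 0 ≤ lam) (hl : lam < 1 / 2) (hp : p ∈ OmegaBar (shift lam)) :
    sol lam α β (F 0 p) = sol (shift lam) (topL lam α β) (topR lam α β) p := by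
  obtain ⟨hS0, hS1⟩ := shift_mem lam
  have hpS := OmegaBar_subset_SG hS0 hS1 hp
  have h := (tendsto_add_atTop_iff_nat 1).2 (tendsto_solApprox h0 (by linarith) α β
    ((F_mem_OmegaBar_iff_of_lt h0 hl hpS).2 hp))
  simp only [solApprox_F_zero_of_lt _ α β hl hpS] at h
  exact tendsto_nhds_unique h (tendsto_solApprox hS0 hS1 _ _ hp)

theorem sol_F_one_of_lt (h0 : 0 ≤ lam) (hl : lam < 1 / 2) (hp : p ∈ SG) :
    sol lam α β (F 1 p) = topL lam α β +
      sol 0 (α - topL lam α β) (bot lam α β - topL lam α β) p := by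
  have h := (tendsto_add_atTop_iff_nat 1).2 (tendsto_solApprox h0 (by linarith) α β
    (F_mem_OmegaBar_of_lt h0 hl (by decide : (1 : Fin 3) ≠ 0) hp))
  simp only [solApprox_F_one_of_lt _ α β hl hp] at h
  rw [← OmegaBar_zero] at hp
  exact tendsto_nhds_unique h ((tendsto_solApprox le_rfl zero_lt_one _ _ hp).const_add _)

theorem sol_F_two_of_lt (h0 : 0 ≤ lam) (hl : lam < 1 / 2) (hp : p ∈ SG) :
    sol lam α β (F 2 p) = topR lam α β +
      sol 0 (bot lam α β - topR lam α β) (β - topR lam α β) p := by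
  have h := (tendsto_add_atTop_iff_nat 1).2 (tendsto_solApprox h0 (by linarith) α β
    (F_mem_OmegaBar_of_lt h0 hl (by decide : (2 : Fin 3) ≠ 0) hp))
  simp only [solApprox_F_two_of_lt _ α β hl hp] at h
  rw [← OmegaBar_zero] at hp
  exact tendsto_nhds_unique h ((tendsto_solApprox le_rfl zero_lt_one _ _ hp).const_add _)

end Subdivision

theorem abs_sol_le {lam α β C : ℝ} (h0 : 0 ≤ lam) (h1 : lam < 1) (hα : |α| ≤ C) (hβ : |β| ≤ C)
    {p : ℝ × ℝ} (hp : p ∈ OmegaBar lam) : |sol lam α β p| ≤ C :=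
  le_of_tendsto' (tendsto_solApprox h0 h1 α β hp).abs fun n => abs_solApprox_le n h0 h1 hα hβ hp

/-- Each digit `0` of `λ` contracts the values near `X`. There are infinitely many of them. -/
theorem abs_sol_le_of_mem_X (k : ℕ) {lam : ℝ} (h0 : 0 ≤ lam) (h1 : lam < 1) :
    ∀ α β C : ℝ, |α| ≤ C → |β| ≤ C → ∀ p ∈ X lam, |sol lam α β p| ≤ C * (3 / 5) ^ k := by
  induction k generalizing lam with
  | zero =>
    intro α β C hα hβ p hp
    rw [pow_zero, mul_one]
    exact abs_sol_le h0 h1 hα hβ (X_subset_OmegaBar lam hp)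
  | succ k ih =>
    refine leading_ones_induction (P := fun lam => ∀ α β C : ℝ, |α| ≤ C → |β| ≤ C → ∀ p ∈ X lam,
      |sol lam α β p| ≤ C * (3 / 5) ^ (k + 1)) ?_ ?_ h0 h1
    · intro lam h0 hl α β C hα hβ p hp
      obtain ⟨p', hp', rfl⟩ := exists_of_mem_X_of_lt h0 hl hp
      obtain ⟨t1, t2⟩ := abs_top_le lam hα hβ
      rw [sol_F_zero_of_lt α β h0 hl (X_subset_OmegaBar _ hp')]
      refine (ih (shift_mem lam).1 (shift_mem lam).2 _ _ _ t1 t2 p' hp').trans_eq ?_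
      ring
    · intro lam hl h1 ih α β C hα hβ p hp
      have hm := abs_mid_le lam hα hβ
      obtain ⟨j, hj, p', hp', rfl⟩ := exists_of_mem_X_of_ge hl h1 hp
      fin_cases j
      · exact absurd rfl hj
      · simp only [Fin.mk_one]
        rw [sol_F_one_of_ge α β hl h1 (X_subset_OmegaBar _ hp')]
        exact ih _ _ _ hα hm p' hp'
      · simp only [Fin.reduceFinMk]
        rw [sol_F_two_of_ge α β hl h1 (X_subset_OmegaBar _ hp')]
        exact ih _ _ _ hm hβ p' hp'

theorem sol_of_mem_X {lam : ℝ} (h0 : 0 ≤ lam) (h1 : lam < 1) (α β : ℝ) {p : ℝ × ℝ}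
    (hp : p ∈ X lam) : sol lam α β p = 0 := by
  refine abs_nonpos_iff.1 (ge_of_tendsto' (tendsto_zero_of_contraction (max |α| |β|)
    (by norm_num : (0 : ℝ) ≤ 3 / 5) (by norm_num)) fun k => ?_)
  exact abs_sol_le_of_mem_X k h0 h1 α β _ (le_max_left _ _) (le_max_right _ _) p hp

/-! ### Normal derivatives and the mean value property -/

/-- The cell of level `k` at a lower corner lies in the lower domain as soon as it is not higher than
the cut. -/
theorem iterate_F_mem_OmegaBar (k : ℕ) {lam : ℝ} (h0 : 0 ≤ lam) (h1 : lam < 1) {j : Fin 3}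
    (hj : j ≠ 0) (hk : (1 / 2 : ℝ) ^ k ≤ 1 - lam) {p : ℝ × ℝ} (hp : p ∈ SG) :
    (F j)^[k] p ∈ OmegaBar lam := by
  induction k generalizing lam with
  | zero =>
    have : lam = 0 := by norm_num at hk; linarith
    rw [this, OmegaBar_zero]
    exact hp
  | succ k ih =>
    rw [Function.iterate_succ_apply']
    have hpk := iterate_F_mem_SG j k hp
    rcases lt_or_ge lam (1 / 2) with hl | hl
    · exact F_mem_OmegaBar_of_lt h0 hl hj hpk
    · refine (F_mem_OmegaBar_iff_of_ge hl h1 hj hpk).2 (ih (shift_mem lam).1 (shift_mem lam).2 ?_)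
      rw [shift_of_ge hl h1]
      rw [pow_succ] at hk
      linarith

/-- The renormalized difference quotient at the corner `q i`, of level `k`; the normal derivative is
its limit. -/
noncomputable def flux (u : ℝ × ℝ → ℝ) (i : Fin 3) (k : ℕ) : ℝ :=
  (5 / 3) ^ k * (2 * u (q i) - u ((F i)^[k] (q (i + 1))) - u ((F i)^[k] (q (i + 2))))

theorem flux_succ (u : ℝ × ℝ → ℝ) (i : Fin 3) (k : ℕ) :
    flux u i (k + 1) = 5 / 3 * flux (fun p => u (F i p)) i k := by
  simp only [flux, Function.iterate_succ_apply', F_q]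
  ring

theorem flux_congr_const_add {u v : ℝ × ℝ → ℝ} {i : Fin 3} {k : ℕ} (c : ℝ)
    (h : ∀ j, u ((F i)^[k] (q j)) = c + v ((F i)^[k] (q j))) : flux u i k = flux v i k := by
  have h0 := h i
  rw [Function.iterate_fixed (F_q i)] at h0
  rw [flux, flux, h0, h, h]
  ring

theorem flux_congr {u v : ℝ × ℝ → ℝ} {i : Fin 3} {k : ℕ}
    (h : ∀ j, u ((F i)^[k] (q j)) = v ((F i)^[k] (q j))) : flux u i k = flux v i k :=
  flux_congr_const_add 0 fun j => (h j).trans (zero_add _).symm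

/-- The difference quotients of `sol` are constant from the first level on for which the cell lies in
the domain. -/
theorem flux_sol_one (k : ℕ) {lam : ℝ} (h0 : 0 ≤ lam) (h1 : lam < 1)
    (hk : (1 / 2 : ℝ) ^ k ≤ 1 - lam) (α β : ℝ) :
    flux (sol lam α β) 1 k = near lam * α - far lam * β := by
  induction k generalizing lam α β with
  | zero =>
    have : lam = 0 := by norm_num at hk; linarith
    subst this
    change (5 / 3 : ℝ) ^ 0 * (2 * sol 0 α β (q 1) - sol 0 α β (q 2) - sol 0 α β (q 0)) = _
    rw [sol_q_one, sol_q_two, sol_zero_q_zero, near_zero, far_zero]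
    ring
  | succ k ih =>
    rw [flux_succ]
    rcases lt_or_ge lam (1 / 2) with hl | hl
    · rw [flux_congr_const_add (topL lam α β) fun j => sol_F_one_of_lt α β h0 hl (iterate_F_mem_SG 1 k (q_mem_SG j)),
        ih le_rfl zero_lt_one ?_, near_zero, far_zero, ← flux_of_lt h0 hl]
      · ring
      · rw [sub_zero]; exact pow_le_one₀ (by norm_num) (by norm_num)
    · obtain ⟨hS0, hS1⟩ := shift_mem lam
      have hk' : (1 / 2 : ℝ) ^ k ≤ 1 - shift lam := by
        rw [shift_of_ge hl h1]; rw [pow_succ] at hk; linarith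
      rw [flux_congr fun j => sol_F_one_of_ge α β hl h1 (iterate_F_mem_OmegaBar k hS0 hS1
        (by decide : (1 : Fin 3) ≠ 0) hk' (q_mem_SG j)), ih hS0 hS1 hk', flux_of_ge hl h1]

theorem flux_sol_two (k : ℕ) {lam : ℝ} (h0 : 0 ≤ lam) (h1 : lam < 1)
    (hk : (1 / 2 : ℝ) ^ k ≤ 1 - lam) (α β : ℝ) :
    flux (sol lam α β) 2 k = near lam * β - far lam * α := by
  induction k generalizing lam α β with
  | zero =>
    have : lam = 0 := by norm_num at hk; linarith
    subst this
    change (5 / 3 : ℝ) ^ 0 * (2 * sol 0 α β (q 2) - sol 0 α β (q 0) - sol 0 α β (q 1)) = _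
    rw [sol_q_one, sol_q_two, sol_zero_q_zero, near_zero, far_zero]
    ring
  | succ k ih =>
    rw [flux_succ]
    rcases lt_or_ge lam (1 / 2) with hl | hl
    · rw [flux_congr_const_add (topR lam α β) fun j => sol_F_two_of_lt α β h0 hl (iterate_F_mem_SG 2 k (q_mem_SG j)),
        ih le_rfl zero_lt_one ?_, near_zero, far_zero, ← flux_of_lt h0 hl,
        topL_comm lam β α, bot_comm lam β α]
      · ring
      · rw [sub_zero]; exact pow_le_one₀ (by norm_num) (by norm_num)
    · obtain ⟨hS0, hS1⟩ := shift_mem lam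
      have hk' : (1 / 2 : ℝ) ^ k ≤ 1 - shift lam := by
        rw [shift_of_ge hl h1]; rw [pow_succ] at hk; linarith
      rw [flux_congr fun j => sol_F_two_of_ge α β hl h1 (iterate_F_mem_OmegaBar k hS0 hS1
        (by decide : (2 : Fin 3) ≠ 0) hk' (q_mem_SG j)), ih hS0 hS1 hk', mid_comm,
        flux_of_ge hl h1]

theorem flux_sol_zero (k : ℕ) (α β : ℝ) : flux (sol 0 α β) 0 k = -(α + β) := by
  induction k generalizing α β with
  | zero =>
    change (5 / 3 : ℝ) ^ 0 * (2 * sol 0 α β (q 0) - sol 0 α β (q 1) - sol 0 α β (q 2)) = _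
    rw [sol_q_one, sol_q_two, sol_zero_q_zero]
    ring
  | succ k ih =>
    have hmem : ∀ j, (F 0)^[k] (q j) ∈ OmegaBar (shift 0) := fun j => by
      rw [shift_zero, OmegaBar_zero]
      exact iterate_F_mem_SG 0 k (q_mem_SG j)
    rw [flux_succ, flux_congr fun j => sol_F_zero_of_lt α β le_rfl (by norm_num) (hmem j),
      shift_zero, ih, topL_add_topR_zero]
    ring

/-- The contribution of the cell `F_w SG` to the mean value property at its vertex `F_w q_i`. -/
noncomputable def cellSum (u : ℝ × ℝ → ℝ) (w : List (Fin 3)) (i : Fin 3) : ℝ :=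
  (u (Fw w (q i)) - u (Fw w (q (i + 1)))) + (u (Fw w (q i)) - u (Fw w (q (i + 2))))

theorem cellSum_cons {u v : ℝ × ℝ → ℝ} {j : Fin 3} {w : List (Fin 3)} (c : ℝ) (i : Fin 3)
    (h : ∀ k, u (F j (Fw w (q k))) = c + v (Fw w (q k))) :
    cellSum u (j :: w) i = cellSum v w i := by
  simp only [cellSum, Fw_cons, h]
  ring

theorem pow_mul_cellSum_replicate (u : ℝ × ℝ → ℝ) (k : ℕ) (i : Fin 3) :
    (5 / 3) ^ k * cellSum u (List.replicate k i) i = flux u i k := by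
  rw [cellSum, flux, Fw_replicate, Function.iterate_fixed (F_q i)]
  ring

theorem height_Fw_q_zero_pos (w : List (Fin 3)) : 0 < (Fw w (q 0)).2 := by
  have h := height_Fw w (q 0) (q 1)
  have h2 := height_nonneg (Fw_mem_SG w (q_mem_SG 1))
  rw [height_q_zero, height_q (by decide)] at h
  have : (0 : ℝ) < (1 / 2) ^ w.length := by positivity
  linarith

theorem cell_subset_shift_of_ge {lam : ℝ} (hl : 1 / 2 ≤ lam) (h1 : lam < 1) {j : Fin 3}
    {w : List (Fin 3)} (h : Fw (j :: w) '' SG ⊆ OmegaBar lam) :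
    j ≠ 0 ∧ Fw w '' SG ⊆ OmegaBar (shift lam) := by
  have hj : j ≠ 0 := by
    rintro rfl
    have h2 := height_le_of_mem (by linarith) h1 (h ⟨q 0, q_mem_SG 0, rfl⟩)
    rw [Fw_cons, height_F_zero] at h2
    have := height_Fw_q_zero_pos w
    linarith
  refine ⟨hj, ?_⟩
  rintro _ ⟨p, hp, rfl⟩
  exact (F_mem_OmegaBar_iff_of_ge hl h1 hj (Fw_mem_SG w hp)).1 (h ⟨p, hp, rfl⟩)

theorem cell_subset_shift_of_lt {lam : ℝ} (h0 : 0 ≤ lam) (hl : lam < 1 / 2)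
    {w : List (Fin 3)} (h : Fw (0 :: w) '' SG ⊆ OmegaBar lam) :
    Fw w '' SG ⊆ OmegaBar (shift lam) := by
  rintro _ ⟨p, hp, rfl⟩
  exact (F_mem_OmegaBar_iff_of_lt h0 hl (Fw_mem_SG w hp)).1 (h ⟨p, hp, rfl⟩)

theorem pow_le_of_cell_subset {lam : ℝ} (h0 : 0 ≤ lam) (h1 : lam < 1) {k : ℕ} {j : Fin 3}
    (hj : j ≠ 0) (h : Fw (List.replicate k j) '' SG ⊆ OmegaBar lam) :
    (1 / 2 : ℝ) ^ k ≤ 1 - lam := by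
  have h2 := height_le_of_mem h0 h1 (h ⟨q 0, q_mem_SG 0, rfl⟩)
  have h3 := height_Fw (List.replicate k j) (q 0) (q j)
  rw [Fw_replicate_q, height_q_zero, height_q hj, List.length_replicate] at h3
  linarith

/-- On a cell of level one, `sol` is, up to a constant, the function `sol` for the domain which that
cell carries, so the sums over its subcells reduce to those of the latter. -/
theorem cellSum_sol_child {lam : ℝ} (h0 : 0 ≤ lam) (h1 : lam < 1) (α β : ℝ) {j : Fin 3}
    {w : List (Fin 3)} (h : Fw (j :: w) '' SG ⊆ OmegaBar lam) :
    ∃ mu α' β', 0 ≤ mu ∧ mu < 1 ∧ ∀ w', Fw (j :: w') '' SG ⊆ OmegaBar lam →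
      Fw w' '' SG ⊆ OmegaBar mu ∧
        ∀ i, cellSum (sol lam α β) (j :: w') i = cellSum (sol mu α' β') w' i := by
  obtain ⟨hS0, hS1⟩ := shift_mem lam
  rcases lt_or_ge lam (1 / 2) with hl | hl
  · fin_cases j
    · refine ⟨shift lam, topL lam α β, topR lam α β, hS0, hS1, fun w' hw' => ?_⟩
      have hsub := cell_subset_shift_of_lt h0 hl hw'
      exact ⟨hsub, fun i => cellSum_cons 0 i fun k => by
        rw [zero_add]
        exact sol_F_zero_of_lt α β h0 hl (hsub ⟨q k, q_mem_SG k, rfl⟩)⟩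
    · refine ⟨0, α - topL lam α β, bot lam α β - topL lam α β, le_rfl, zero_lt_one,
        fun w' hw' => ⟨?_, fun i => cellSum_cons (topL lam α β) i fun k =>
          sol_F_one_of_lt α β h0 hl (Fw_mem_SG w' (q_mem_SG k))⟩⟩
      rw [OmegaBar_zero]
      rintro _ ⟨p, hp, rfl⟩
      exact Fw_mem_SG w' hp
    · refine ⟨0, bot lam α β - topR lam α β, β - topR lam α β, le_rfl, zero_lt_one,
        fun w' hw' => ⟨?_, fun i => cellSum_cons (topR lam α β) i fun k =>
          sol_F_two_of_lt α β h0 hl (Fw_mem_SG w' (q_mem_SG k))⟩⟩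
      rw [OmegaBar_zero]
      rintro _ ⟨p, hp, rfl⟩
      exact Fw_mem_SG w' hp
  · have hj := (cell_subset_shift_of_ge hl h1 h).1
    fin_cases j
    · exact absurd rfl hj
    · refine ⟨shift lam, α, mid lam α β, hS0, hS1, fun w' hw' => ?_⟩
      have hsub := (cell_subset_shift_of_ge hl h1 hw').2
      exact ⟨hsub, fun i => cellSum_cons 0 i fun k => by
        rw [zero_add]
        exact sol_F_one_of_ge α β hl h1 (hsub ⟨q k, q_mem_SG k, rfl⟩)⟩
    · refine ⟨shift lam, mid lam α β, β, hS0, hS1, fun w' hw' => ?_⟩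
      have hsub := (cell_subset_shift_of_ge hl h1 hw').2
      exact ⟨hsub, fun i => cellSum_cons 0 i fun k => by
        rw [zero_add]
        exact sol_F_two_of_ge α β hl h1 (hsub ⟨q k, q_mem_SG k, rfl⟩)⟩

/-- The mean value property at the common vertex `F_j q_j' = F_j' q_j` of two cells of level one, for
the subcells of any level: the sums over the subcells are normal derivatives, and these cancel by the
choice of the values at the vertices of level one. -/
theorem cellSum_junction {lam : ℝ} (h0 : 0 ≤ lam) (h1 : lam < 1) (α β : ℝ) {j j' : Fin 3}
    (hjj : j < j') (k : ℕ)
    (hc : Fw (j :: List.replicate k j') '' SG ⊆ OmegaBar lam)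
    (hc' : Fw (j' :: List.replicate k j) '' SG ⊆ OmegaBar lam) :
    cellSum (sol lam α β) (j :: List.replicate k j') j' +
      cellSum (sol lam α β) (j' :: List.replicate k j) j = 0 := by
  obtain ⟨hS0, hS1⟩ := shift_mem lam
  have h53 : ((5 : ℝ) / 3) ^ k ≠ 0 := by positivity
  have hpow0 : (1 / 2 : ℝ) ^ k ≤ 1 - 0 := by
    rw [sub_zero]; exact pow_le_one₀ (by norm_num) (by norm_num)
  refine (mul_eq_zero.1 ?_).resolve_left h53
  rw [mul_add]
  rcases lt_or_ge lam (1 / 2) with hl | hl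
  · have hL : ∀ i, (5 / 3) ^ k * cellSum (sol lam α β) (1 :: List.replicate k i) i =
        flux (sol 0 (α - topL lam α β) (bot lam α β - topL lam α β)) i k := fun i => by
      rw [cellSum_cons (topL lam α β) i fun l =>
        sol_F_one_of_lt α β h0 hl (Fw_mem_SG _ (q_mem_SG l)), pow_mul_cellSum_replicate]
    have hR : ∀ i, (5 / 3) ^ k * cellSum (sol lam α β) (2 :: List.replicate k i) i =
        flux (sol 0 (bot lam α β - topR lam α β) (β - topR lam α β)) i k := fun i => by
      rw [cellSum_cons (topR lam α β) i fun l =>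
        sol_F_two_of_lt α β h0 hl (Fw_mem_SG _ (q_mem_SG l)), pow_mul_cellSum_replicate]
    have hT : ∀ i, Fw (List.replicate k i) '' SG ⊆ OmegaBar (shift lam) →
        (5 / 3) ^ k * cellSum (sol lam α β) (0 :: List.replicate k i) i =
          flux (sol (shift lam) (topL lam α β) (topR lam α β)) i k := fun i hsub => by
      rw [cellSum_cons (v := sol (shift lam) (topL lam α β) (topR lam α β)) 0 i fun l => by
        rw [zero_add]; exact sol_F_zero_of_lt α β h0 hl (hsub ⟨q l, q_mem_SG l, rfl⟩),
        pow_mul_cellSum_replicate]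
    have hcases : (j = 0 ∧ j' = 1) ∨ (j = 0 ∧ j' = 2) ∨ (j = 1 ∧ j' = 2) := by
      clear hc hc'; revert hjj; revert j j'; decide
    rcases hcases with ⟨rfl, rfl⟩ | ⟨rfl, rfl⟩ | ⟨rfl, rfl⟩
    · have hsub := cell_subset_shift_of_lt h0 hl hc
      rw [hT 1 hsub, hL, flux_sol_zero, flux_sol_one k hS0 hS1
        (pow_le_of_cell_subset hS0 hS1 (by decide) hsub), ← topL_balance lam α β]
      ring
    · have hsub := cell_subset_shift_of_lt h0 hl hc
      rw [hT 2 hsub, hR, flux_sol_zero, flux_sol_two k hS0 hS1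
        (pow_le_of_cell_subset hS0 hS1 (by decide) hsub), ← topR_balance lam α β]
      ring
    · rw [hL, hR, flux_sol_two k le_rfl zero_lt_one hpow0,
        flux_sol_one k le_rfl zero_lt_one hpow0, near_zero, far_zero, ← bot_balance lam α β]
      ring
  · obtain ⟨hj, hsub⟩ := cell_subset_shift_of_ge hl h1 hc
    obtain ⟨hj', hsub'⟩ := cell_subset_shift_of_ge hl h1 hc'
    have hcases : j = 1 ∧ j' = 2 := by
      revert hj hj' hjj; clear hc hc' hsub hsub'; revert j j'; decide
    obtain ⟨rfl, rfl⟩ := hcases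
    rw [cellSum_cons (v := sol (shift lam) α (mid lam α β)) 0 2 fun l => by
        rw [zero_add]; exact sol_F_one_of_ge α β hl h1 (hsub ⟨q l, q_mem_SG l, rfl⟩),
      cellSum_cons (v := sol (shift lam) (mid lam α β) β) 0 1 fun l => by
        rw [zero_add]; exact sol_F_two_of_ge α β hl h1 (hsub' ⟨q l, q_mem_SG l, rfl⟩),
      pow_mul_cellSum_replicate, pow_mul_cellSum_replicate,
      flux_sol_two k hS0 hS1 (pow_le_of_cell_subset hS0 hS1 (by decide) hsub),
      flux_sol_one k hS0 hS1 (pow_le_of_cell_subset hS0 hS1 (by decide) hsub'),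
      mid_balance lam α β]

/-- Existence of harmonic functions. Two cells in the same cell of level one reduce to shorter words;
two cells in different ones can meet only at a vertex of level one. -/
theorem isHarmonic_sol {lam : ℝ} (h0 : 0 ≤ lam) (h1 : lam < 1) (α β : ℝ) :
    IsHarmonic lam (sol lam α β) where
  continuousOn := continuousOn_sol h0 h1 α β
  mean_value := by
    have key : ∀ (w w' : List (Fin 3)) (i i' : Fin 3) (lam α β : ℝ), 0 ≤ lam → lam < 1 →
        w.length = w'.length → w ≠ w' → Fw w (q i) = Fw w' (q i') →
        Fw w '' SG ⊆ OmegaBar lam → Fw w' '' SG ⊆ OmegaBar lam →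
        cellSum (sol lam α β) w i + cellSum (sol lam α β) w' i' = 0 := by
      intro w
      induction w with
      | nil =>
        intro w' i i' lam α β h0 h1 hlen hne
        exact absurd (List.length_eq_zero_iff.1 hlen.symm).symm hne
      | cons j v ih =>
        intro w' i i' lam α β h0 h1 hlen hne hx hc hc'
        cases w' with
        | nil => simp at hlen
        | cons j' v' =>
          have hlen' : v.length = v'.length := by simpa using hlen
          by_cases hjj : j = j'
          · subst hjj
            obtain ⟨mu, α', β', hm0, hm1, h⟩ := cellSum_sol_child h0 h1 α β hc
            rw [(h v hc).2, (h v' hc').2]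
            refine ih v' i i' mu α' β' hm0 hm1 hlen' (fun e => hne (by rw [e])) ?_
              (h v hc).1 (h v' hc').1
            exact F_injective j hx
          · have e1 := eq_q_of_F_eq_F (Fw_mem_SG v (q_mem_SG i)) (Fw_mem_SG v' (q_mem_SG i')) hjj hx
            have e2 := eq_q_of_F_eq_F (Fw_mem_SG v' (q_mem_SG i')) (Fw_mem_SG v (q_mem_SG i))
              (Ne.symm hjj) hx.symm
            obtain ⟨e3, rfl⟩ := eq_replicate_of_Fw_eq_q e1
            obtain ⟨e4, rfl⟩ := eq_replicate_of_Fw_eq_q e2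
            rw [← hlen'] at e4
            rw [e4] at hc' ⊢
            rw [e3] at hc ⊢
            simp only [List.length_replicate] at hc' ⊢
            rcases lt_or_gt_of_ne hjj with hlt | hlt
            · exact cellSum_junction h0 h1 α β hlt _ hc hc'
            · rw [add_comm]
              exact cellSum_junction h0 h1 α β hlt _ hc' hc
    intro w w' i i' hlen hne hx hc hc'
    have := key w w' i i' lam α β h0 h1 hlen hne hx hc hc'
    simp only [cellSum] at this
    linarith

/-! ### Identification of `η₁`, `η₂` -/

/-- `u` has, at all vertices of the closed lower domain, the values of the harmonic function with the
boundary values `α`, `β` at `q₁`, `q₂` and `0` on `X`. -/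
def AgreesWithSol (lam α β : ℝ) (u : ℝ × ℝ → ℝ) : Prop :=
  ∀ m, ∀ p ∈ V m, p ∈ OmegaBar lam → u p = sol lam α β p

/-- Uniqueness: a harmonic function vanishing on `X` is determined at the vertices by its values at
`q₁` and `q₂`. -/
theorem IsHarmonic.agreesWithSol {lam : ℝ} (h0 : 0 ≤ lam) (h1 : lam < 1) {u : ℝ × ℝ → ℝ}
    (hu : IsHarmonic lam u) (hX : ∀ p ∈ X lam, u p = 0) :
    AgreesWithSol lam (u (q 1)) (u (q 2)) u := fun _ _ hpV hp =>
  hu.eq_of_boundary h0 h1 (isHarmonic_sol h0 h1 _ _) (sol_q_one _ _ _).symm (sol_q_two _ _ _).symm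
    (fun p hp => by rw [hX p hp, sol_of_mem_X h0 h1 _ _ hp]) hpV hp

theorem normalDeriv_eq_of_flux {u : ℝ × ℝ → ℝ} {i : Fin 3} {c : ℝ}
    (h : ∀ᶠ k in atTop, flux u i k = c) : normalDeriv u i = c := by
  have hi : i - 1 = i + 2 := by fin_cases i <;> rfl
  refine Tendsto.limUnder_eq ((tendsto_congr' ?_).2 tendsto_const_nhds)
  filter_upwards [h] with k hk
  rw [← hk, flux, hi]

theorem AgreesWithSol.eventually_flux {lam α β : ℝ} {u : ℝ × ℝ → ℝ} (h0 : 0 ≤ lam) (h1 : lam < 1)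
    (h : AgreesWithSol lam α β u) {i : Fin 3} (hi : i ≠ 0) :
    ∀ᶠ k in atTop, (1 / 2 : ℝ) ^ k ≤ 1 - lam ∧ flux u i k = flux (sol lam α β) i k := by
  have ht := tendsto_pow_atTop_nhds_zero_of_lt_one (r := (1 / 2 : ℝ)) (by norm_num) (by norm_num)
  filter_upwards [ht.eventually (ge_mem_nhds (by linarith : 0 < 1 - lam))] with k hk
  refine ⟨hk, flux_congr fun j => h k _ ?_ (iterate_F_mem_OmegaBar k h0 h1 hi hk (q_mem_SG j))⟩
  have := Fw_q_mem_V (List.replicate k i) j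
  rwa [Fw_replicate, List.length_replicate] at this

theorem AgreesWithSol.normalDeriv_one {lam α β : ℝ} {u : ℝ × ℝ → ℝ} (h0 : 0 ≤ lam) (h1 : lam < 1)
    (h : AgreesWithSol lam α β u) : normalDeriv u 1 = near lam * α - far lam * β := by
  refine normalDeriv_eq_of_flux ?_
  filter_upwards [h.eventually_flux h0 h1 (by decide : (1 : Fin 3) ≠ 0)] with k hk
  rw [hk.2, flux_sol_one k h0 h1 hk.1]

theorem AgreesWithSol.normalDeriv_two {lam α β : ℝ} {u : ℝ × ℝ → ℝ} (h0 : 0 ≤ lam) (h1 : lam < 1)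
    (h : AgreesWithSol lam α β u) : normalDeriv u 2 = near lam * β - far lam * α := by
  refine normalDeriv_eq_of_flux ?_
  filter_upwards [h.eventually_flux h0 h1 (by decide : (2 : Fin 3) ≠ 0)] with k hk
  rw [hk.2, flux_sol_two k h0 h1 hk.1]

theorem AgreesWithSol.comp_F_one {lam α β : ℝ} {u : ℝ × ℝ → ℝ} (hl : 1 / 2 ≤ lam) (h1 : lam < 1)
    (h : AgreesWithSol lam α β u) : AgreesWithSol (shift lam) α (mid lam α β) (u ∘ F 1) := by
  intro m p hpV hp
  have hpS := V_subset_SG m hpV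
  rw [← sol_F_one_of_ge α β hl h1 hp]
  exact h (m + 1) _ (F_mem_V 1 hpV) ((F_mem_OmegaBar_iff_of_ge hl h1 (by decide) hpS).2 hp)

theorem AgreesWithSol.comp_F_two {lam α β : ℝ} {u : ℝ × ℝ → ℝ} (hl : 1 / 2 ≤ lam) (h1 : lam < 1)
    (h : AgreesWithSol lam α β u) : AgreesWithSol (shift lam) (mid lam α β) β (u ∘ F 2) := by
  intro m p hpV hp
  have hpS := V_subset_SG m hpV
  rw [← sol_F_two_of_ge α β hl h1 hp]
  exact h (m + 1) _ (F_mem_V 2 hpV) ((F_mem_OmegaBar_iff_of_ge hl h1 (by decide) hpS).2 hp)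

theorem isH1_h1 {lam : ℝ} (h0 : 0 ≤ lam) (h1 : lam < 1) : IsH1 lam (Gasket.h1 lam) :=
  Classical.epsilon_spec (p := IsH1 lam) ⟨sol lam 1 0, isHarmonic_sol h0 h1 1 0, sol_q_one _ _ _,
    sol_q_two _ _ _, fun _ hp => sol_of_mem_X h0 h1 1 0 hp⟩

theorem agreesWithSol_h1 {lam : ℝ} (h0 : 0 ≤ lam) (h1 : lam < 1) :
    AgreesWithSol lam 1 0 (Gasket.h1 lam) := by
  obtain ⟨hh, hq1, hq2, hX⟩ := isH1_h1 h0 h1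
  have := hh.agreesWithSol h0 h1 hX
  rwa [hq1, hq2] at this

theorem eta1_eq {lam : ℝ} (h0 : 0 ≤ lam) (h1 : lam < 1) : eta1 lam = near lam := by
  rw [eta1, (agreesWithSol_h1 h0 h1).normalDeriv_one h0 h1]; ring

theorem eta2_eq {lam : ℝ} (h0 : 0 ≤ lam) (h1 : lam < 1) : eta2 lam = far lam := by
  rw [eta2, (agreesWithSol_h1 h0 h1).normalDeriv_two h0 h1]; ring

/-! ### Transfer matrices along the digits `1` -/

theorem cellNormalDeriv_cons (u : ℝ × ℝ → ℝ) (j : Fin 3) (w : List (Fin 3)) (i : Fin 3) :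
    cellNormalDeriv u (j :: w) i = 5 / 3 * cellNormalDeriv (u ∘ F j) w i := by
  rw [cellNormalDeriv, cellNormalDeriv, List.length_cons, pow_succ]
  change _ * normalDeriv ((u ∘ F j) ∘ Fw w) i = _
  ring

/-- The first `m` binary digits of `λ` are `1`. -/
def StartsWithOnes (m : ℕ) (lam : ℝ) : Prop := ∀ k : ℕ, 1 ≤ k → k ≤ m → digit lam k = 1

theorem StartsWithOnes.half_le {m : ℕ} {lam : ℝ} (h : StartsWithOnes (m + 1) lam) :
    1 / 2 ≤ lam :=
  half_le_of_digit_one (h 1 le_rfl (by omega))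

theorem StartsWithOnes.shift {m : ℕ} {lam : ℝ} (h : StartsWithOnes (m + 1) lam) :
    StartsWithOnes m (shift lam) := by
  intro k hk hkm
  have := h.half_le
  rw [digit_shift (by linarith) hk]
  exact h (k + 1) (by omega) (by omega)

theorem StartsWithOnes.exists_of_mem_words {m : ℕ} {lam : ℝ} (h : StartsWithOnes (m + 1) lam)
    {w : List (Fin 3)} (hw : w ∈ words lam (m + 1)) :
    ∃ j v, w = j :: v ∧ (j = 1 ∨ j = 2) ∧ v ∈ words (Gasket.shift lam) m := by
  obtain ⟨hlen, hdig⟩ := hw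
  cases w with
  | nil => simp at hlen
  | cons j v =>
    refine ⟨j, v, rfl, (hdig 0 (by simp)).2 (h 1 le_rfl (by omega)), by simpa using hlen,
      fun k hk => ?_⟩
    have := h.half_le
    rw [digit_shift (by linarith) (by omega)]
    exact hdig (k + 1) (by simpa using hk)

theorem M_one_eq_far_near (lam : ℝ) : M lam 1 =
    !![1, 0; -(far (shift lam) / (2 * near (shift lam))),
      far (shift lam) / (2 * near (shift lam))] := by
  rw [← eta1_eq (shift_mem lam).1 (shift_mem lam).2, ← eta2_eq (shift_mem lam).1 (shift_mem lam).2]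
  rfl

theorem M_two_eq_far_near (lam : ℝ) : M lam 2 =
    !![far (shift lam) / (2 * near (shift lam)), -(far (shift lam) / (2 * near (shift lam)));
      0, 1] := by
  rw [← eta1_eq (shift_mem lam).1 (shift_mem lam).2, ← eta2_eq (shift_mem lam).1 (shift_mem lam).2]
  rfl

theorem M_one_mulVec {lam : ℝ} (hl : 1 / 2 ≤ lam) (h1 : lam < 1) (α β : ℝ) :
    (M lam 1).mulVec ![near lam * α - far lam * β, near lam * β - far lam * α] =
      (5 / 3 : ℝ) • ![near (shift lam) * α - far (shift lam) * mid lam α β,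
        near (shift lam) * mid lam α β - far (shift lam) * α] := by
  have hA := (far_pos (shift_mem lam).1 (shift_mem lam).2).trans
    (far_lt_near (shift_mem lam).1 (shift_mem lam).2)
  rw [M_one_eq_far_near, ← flux_of_ge hl h1 α β, ← flux_of_ge hl h1 β α, mid_comm lam β α]
  ext i
  fin_cases i
  · simp
  · simp [mid]
    field_simp
    ring

theorem M_two_mulVec {lam : ℝ} (hl : 1 / 2 ≤ lam) (h1 : lam < 1) (α β : ℝ) :
    (M lam 2).mulVec ![near lam * α - far lam * β, near lam * β - far lam * α] =
      (5 / 3 : ℝ) • ![near (shift lam) * mid lam α β - far (shift lam) * β,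
        near (shift lam) * β - far (shift lam) * mid lam α β] := by
  have hA := (far_pos (shift_mem lam).1 (shift_mem lam).2).trans
    (far_lt_near (shift_mem lam).1 (shift_mem lam).2)
  rw [M_two_eq_far_near, ← flux_of_ge hl h1 α β, ← flux_of_ge hl h1 β α, mid_comm lam β α]
  ext i
  fin_cases i
  · simp [mid]
    field_simp
    ring
  · simp

/-- The transfer matrices act on the normal derivatives. The factor `(5 / 3) ^ |w|` in the definition
of the normal derivatives of a cell is absorbed by `M_one_mulVec` and `M_two_mulVec`. -/
theorem AgreesWithSol.cellNormalDeriv_eq {m : ℕ} {lam α β : ℝ} {u : ℝ × ℝ → ℝ} (h0 : 0 ≤ lam)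
    (h1 : lam < 1) (hd : StartsWithOnes m lam) (h : AgreesWithSol lam α β u)
    {w : List (Fin 3)} (hw : w ∈ words lam m) :
    ![cellNormalDeriv u w 1, cellNormalDeriv u w 2] =
      (Mw lam w).mulVec ![near lam * α - far lam * β, near lam * β - far lam * α] := by
  induction m generalizing lam α β u w with
  | zero =>
    obtain rfl := List.length_eq_zero_iff.1 hw.1
    rw [← h.normalDeriv_one h0 h1, ← h.normalDeriv_two h0 h1, Mw, Matrix.one_mulVec]
    simp [cellNormalDeriv, Fw]
  | succ m ih =>
    have hl := hd.half_le
    obtain ⟨hS0, hS1⟩ := shift_mem lam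
    obtain ⟨j, v, rfl, hj, hv⟩ := hd.exists_of_mem_words hw
    have hvec : ∀ j, ![cellNormalDeriv u (j :: v) 1, cellNormalDeriv u (j :: v) 2] =
        (5 / 3 : ℝ) • ![cellNormalDeriv (u ∘ F j) v 1, cellNormalDeriv (u ∘ F j) v 2] := by
      intro j
      rw [cellNormalDeriv_cons, cellNormalDeriv_cons]
      simp
    rw [hvec, Mw, ← Matrix.mulVec_mulVec]
    rcases hj with rfl | rfl
    · rw [M_one_mulVec hl h1, Matrix.mulVec_smul, ih hS0 hS1 hd.shift (h.comp_F_one hl h1) hv]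
    · rw [M_two_mulVec hl h1, Matrix.mulVec_smul, ih hS0 hS1 hd.shift (h.comp_F_two hl h1) hv]

/-- With `y = e^{-t}`, the relation says that `near / far = cosh t`, and a digit `1` in front doubles
`t`. -/
theorem near_eq_of_ge {lam y : ℝ} (hl : 1 / 2 ≤ lam) (h1 : lam < 1) (hy : 0 < y)
    (h : near (shift lam) = far (shift lam) * ((y + y⁻¹) / 2)) :
    near lam = far lam * ((y ^ 2 + (y ^ 2)⁻¹) / 2) ∧
      far lam = 5 / 3 * (far (shift lam) / (y + y⁻¹)) := by
  have hB := far_pos (shift_mem lam).1 (shift_mem lam).2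
  have hyi : 0 < y + y⁻¹ := by positivity
  rw [near_of_ge hl h1, far_of_ge hl h1, h]
  constructor <;> field_simp <;> ring

/-- The parameter `x` at `S^m λ` becomes `x ^ 2 ^ m` at `λ`. -/
theorem StartsWithOnes.near_eq {m : ℕ} {lam x : ℝ} (h0 : 0 ≤ lam) (h1 : lam < 1)
    (hd : StartsWithOnes m lam) (hx : 0 < x)
    (h : near (Gasket.shift^[m] lam) = far (Gasket.shift^[m] lam) * ((x + x⁻¹) / 2)) :
    near lam = far lam * ((x ^ 2 ^ m + (x ^ 2 ^ m)⁻¹) / 2) := by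
  induction m generalizing lam with
  | zero => simpa using h
  | succ m ih =>
    have := (near_eq_of_ge hd.half_le h1 (by positivity)
      (ih (shift_mem lam).1 (shift_mem lam).2 hd.shift h)).1
    rwa [← pow_mul, ← pow_succ] at this

theorem StartsWithOnes.far_eq {m : ℕ} {lam x : ℝ} (h0 : 0 ≤ lam) (h1 : lam < 1)
    (hd : StartsWithOnes m lam) (hx : 0 < x) (hx1 : x < 1)
    (h : near (Gasket.shift^[m] lam) = far (Gasket.shift^[m] lam) * ((x + x⁻¹) / 2)) :
    far lam = (5 / 3) ^ m * ((x - x⁻¹) / (x ^ 2 ^ m - (x ^ 2 ^ m)⁻¹)) *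
      far (Gasket.shift^[m] lam) := by
  induction m generalizing lam with
  | zero =>
    have : x - x⁻¹ ≠ 0 := by
      have := (one_lt_inv₀ hx).2 hx1
      linarith
    simp [div_self this]
  | succ m ih =>
    have hr := hd.shift.near_eq (shift_mem lam).1 (shift_mem lam).2 hx h
    have hy : 0 < x ^ 2 ^ m := by positivity
    have hy1 : x ^ 2 ^ m < 1 := pow_lt_one₀ hx.le hx1 (by positivity)
    rw [(near_eq_of_ge hd.half_le h1 hy hr).2, ih (shift_mem lam).1 (shift_mem lam).2 hd.shift h,
      Function.iterate_succ_apply, pow_succ 2 m, pow_mul]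
    set y := x ^ 2 ^ m
    have e1 : y - y⁻¹ ≠ 0 := by
      have := (one_lt_inv₀ hy).2 hy1
      linarith
    have e2 : y + y⁻¹ ≠ 0 := by positivity
    have e3 : y ^ 2 - (y ^ 2)⁻¹ = (y - y⁻¹) * (y + y⁻¹) := by rw [← inv_pow]; ring
    rw [e3]
    generalize far _ = B
    generalize x - x⁻¹ = c
    generalize y - y⁻¹ = d at *
    generalize y + y⁻¹ = e at *
    rw [pow_succ]
    field_simp

/-- The solution is `r - √(r² - 1)`. -/
theorem existsUnique_half_add_inv {r : ℝ} (hr : 1 < r) :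
    ∃! x : ℝ, 0 < x ∧ x < 1 ∧ r = (x + x⁻¹) / 2 := by
  have hs : √(r ^ 2 - 1) ^ 2 = r ^ 2 - 1 := Real.sq_sqrt (by nlinarith)
  have hs0 : 0 < √(r ^ 2 - 1) := Real.sqrt_pos.2 (by nlinarith)
  set s := √(r ^ 2 - 1)
  have hmul : (r - s) * (r + s) = 1 := by linear_combination -hs
  have hpos : 0 < r - s := by nlinarith
  refine ⟨r - s, ⟨hpos, by nlinarith, ?_⟩, ?_⟩
  · rw [inv_eq_of_mul_eq_one_right hmul]
    ring
  · rintro y ⟨hy0, hy1, hy⟩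
    have h1 : y ^ 2 - 2 * r * y + 1 = 0 := by
      rw [hy]; field_simp; ring
    have h2 : (y - (r - s)) * (y - (r + s)) = 0 := by linear_combination h1 + hmul
    rcases mul_eq_zero.1 h2 with h | h
    · linarith
    · linarith

theorem isUnit_det {y : ℝ} (hy : 0 < y) (hy1 : y < 1) : IsUnit !![1, -y; -y, 1].det := by
  rw [Matrix.det_fin_two_of, isUnit_iff_ne_zero]
  nlinarith

theorem M_one_eq {lam y : ℝ} (hy : 0 < y) (hy1 : y < 1)
    (h : near (shift lam) = far (shift lam) * ((y + y⁻¹) / 2)) :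
    M lam 1 = !![1, -y; -y, 1] * !![1, 0; 0, y] * !![1, -y ^ 2; -y ^ 2, 1]⁻¹ := by
  have hB := far_pos (shift_mem lam).1 (shift_mem lam).2
  have hu := isUnit_det (by positivity : 0 < y ^ 2) (pow_lt_one₀ hy.le hy1 two_ne_zero)
  have hr : far (shift lam) / (2 * near (shift lam)) = y / (1 + y ^ 2) := by
    rw [h]; field_simp; ring
  have key : M lam 1 * !![1, -y ^ 2; -y ^ 2, 1] = !![1, -y; -y, 1] * !![1, 0; 0, y] := by
    rw [M_one_eq_far_near, hr, Matrix.mul_fin_two, Matrix.mul_fin_two]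
    congr 1
    ext i j
    fin_cases i <;> fin_cases j <;> simp <;> field_simp <;> ring
  rw [← key, Matrix.mul_nonsing_inv_cancel_right _ _ hu]

theorem M_two_eq {lam y : ℝ} (hy : 0 < y) (hy1 : y < 1)
    (h : near (shift lam) = far (shift lam) * ((y + y⁻¹) / 2)) :
    M lam 2 = !![1, -y; -y, 1] * !![y, 0; 0, 1] * !![1, -y ^ 2; -y ^ 2, 1]⁻¹ := by
  have hB := far_pos (shift_mem lam).1 (shift_mem lam).2
  have hu := isUnit_det (by positivity : 0 < y ^ 2) (pow_lt_one₀ hy.le hy1 two_ne_zero)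
  have hr : far (shift lam) / (2 * near (shift lam)) = y / (1 + y ^ 2) := by
    rw [h]; field_simp; ring
  have key : M lam 2 * !![1, -y ^ 2; -y ^ 2, 1] = !![1, -y; -y, 1] * !![y, 0; 0, 1] := by
    rw [M_two_eq_far_near, hr, Matrix.mul_fin_two, Matrix.mul_fin_two]
    congr 1
    ext i j
    fin_cases i <;> fin_cases j <;> simp <;> field_simp <;> ring
  rw [← key, Matrix.mul_nonsing_inv_cancel_right _ _ hu]

/-- By induction on `m`: with `N y = !![1, -y; -y, 1]` and `y = x ^ 2 ^ m`, each of `M₁`, `M₂` is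
`N y * D * (N (y ^ 2))⁻¹` with a diagonal matrix `D`, so the product telescopes. -/
theorem StartsWithOnes.exists_Mw_eq {m : ℕ} {lam x : ℝ} (h0 : 0 ≤ lam) (h1 : lam < 1)
    (hd : StartsWithOnes m lam) (hx : 0 < x) (hx1 : x < 1)
    (h : near (Gasket.shift^[m] lam) = far (Gasket.shift^[m] lam) * ((x + x⁻¹) / 2))
    {w : List (Fin 3)} (hw : w ∈ words lam m) :
    ∃ j : ℕ, j ≤ 2 ^ m - 1 ∧
      (j : ℤ) = ∑ k : Fin w.length, (((w.get k : ℕ) : ℤ) - 1) * 2 ^ (m - ((k : ℕ) + 1)) ∧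
      Mw lam w = !![x ^ j, -x ^ (2 ^ m - j); -x ^ (j + 1), x ^ (2 ^ m - j - 1)] *
        (!![1, -x ^ 2 ^ m; -x ^ 2 ^ m, 1])⁻¹ := by
  induction m generalizing lam w with
  | zero =>
    obtain rfl := List.length_eq_zero_iff.1 hw.1
    refine ⟨0, by simp, by simp, ?_⟩
    have := Matrix.mul_nonsing_inv _ (isUnit_det hx hx1)
    simpa [Mw] using this.symm
  | succ m ih =>
    obtain ⟨hS0, hS1⟩ := shift_mem lam
    obtain ⟨i, v, rfl, hi, hv⟩ := hd.exists_of_mem_words hw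
    obtain ⟨j, hj, hsum, hM⟩ := ih hS0 hS1 hd.shift h hv
    have hr := hd.shift.near_eq hS0 hS1 hx h
    have hy : 0 < x ^ 2 ^ m := by positivity
    have hy1 : x ^ 2 ^ m < 1 := pow_lt_one₀ hx.le hx1 (by positivity)
    have hu := isUnit_det hy hy1
    have h2 : 0 < 2 ^ m := by positivity
    have hsum' : ∑ k : Fin (i :: v).length, ((((i :: v).get k : ℕ) : ℤ) - 1) *
        2 ^ (m + 1 - ((k : ℕ) + 1)) = ((i : ℕ) - 1 : ℤ) * 2 ^ m + j := by
      rw [hsum]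
      change ∑ k : Fin (v.length + 1), _ = _
      rw [Fin.sum_univ_succ]
      simp
    rw [hsum']
    have hpow : x ^ 2 ^ (m + 1) = (x ^ 2 ^ m) ^ 2 := by rw [pow_succ, pow_mul]
    rcases hi with rfl | rfl
    · refine ⟨j, by rw [pow_succ]; omega, by simp, ?_⟩
      rw [Mw, hM, M_one_eq hy hy1 hr, hpow, ← Matrix.mul_assoc, ← Matrix.mul_assoc,
        Matrix.nonsing_inv_mul_cancel_right _ _ hu]
      congr 1
      have e1 : 2 ^ (m + 1) - j = 2 ^ m - j + 2 ^ m := by rw [pow_succ]; omega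
      have e2 : 2 ^ (m + 1) - j - 1 = 2 ^ m - j - 1 + 2 ^ m := by rw [pow_succ]; omega
      rw [Matrix.mul_fin_two, e2, e1]
      simp [pow_add]
    · refine ⟨2 ^ m + j, by rw [pow_succ]; omega, by push_cast; norm_num, ?_⟩
      rw [Mw, hM, M_two_eq hy hy1 hr, hpow, ← Matrix.mul_assoc, ← Matrix.mul_assoc,
        Matrix.nonsing_inv_mul_cancel_right _ _ hu]
      congr 1
      have e1 : 2 ^ (m + 1) - (2 ^ m + j) = 2 ^ m - j := by rw [pow_succ]; omega
      rw [Matrix.mul_fin_two, e1, add_assoc, pow_add x (2 ^ m), pow_add x (2 ^ m)]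
      simp [mul_comm]

theorem iterate_shift_mem {lam : ℝ} (h0 : 0 ≤ lam) (h1 : lam < 1) (m : ℕ) :
    0 ≤ shift^[m] lam ∧ shift^[m] lam < 1 := by
  cases m with
  | zero => exact ⟨h0, h1⟩
  | succ m => rw [Function.iterate_succ_apply']; exact shift_mem _

end Gasket

theorem proposition4p9 (lam : ℝ) (hlam0 : 0 ≤ lam) (hlam1 : lam < 1) (m : ℕ)
    (hdigits : ∀ k : ℕ, 1 ≤ k → k ≤ m → Gasket.digit lam k = 1) :
    -- the equation defining `x ∈ (0, 1)` has exactly one solution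
    (∃! x : ℝ, 0 < x ∧ x < 1 ∧
      Gasket.eta1 (Gasket.shift^[m] lam) / Gasket.eta2 (Gasket.shift^[m] lam) =
        (x + x⁻¹) / 2) ∧
    -- `M_w^λ` transforms the normal derivatives of the harmonic functions vanishing on `X`
    (∀ w ∈ Gasket.words lam m, ∀ u : ℝ × ℝ → ℝ,
      Gasket.IsHarmonic lam u → (∀ p ∈ Gasket.X lam, u p = 0) →
        ![Gasket.cellNormalDeriv u w 1, Gasket.cellNormalDeriv u w 2] =
          (Gasket.Mw lam w).mulVec ![Gasket.normalDeriv u 1, Gasket.normalDeriv u 2]) ∧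
    ∀ x : ℝ, 0 < x → x < 1 →
      Gasket.eta1 (Gasket.shift^[m] lam) / Gasket.eta2 (Gasket.shift^[m] lam) =
        (x + x⁻¹) / 2 →
      -- (a)
      (Gasket.eta1 lam = (5 / 3) ^ m * ((x - x⁻¹) / (x + x⁻¹)) *
          ((x ^ 2 ^ m + (x ^ 2 ^ m)⁻¹) / (x ^ 2 ^ m - (x ^ 2 ^ m)⁻¹)) *
          Gasket.eta1 (Gasket.shift^[m] lam) ∧
        Gasket.eta2 lam = (5 / 3) ^ m * ((x - x⁻¹) / (x ^ 2 ^ m - (x ^ 2 ^ m)⁻¹)) *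
          Gasket.eta2 (Gasket.shift^[m] lam)) ∧
      -- (b)
      ∀ w ∈ Gasket.words lam m,
        ∃ j : ℕ, j ≤ 2 ^ m - 1 ∧
          (j : ℤ) = ∑ k : Fin w.length, (((w.get k : ℕ) : ℤ) - 1) * 2 ^ (m - ((k : ℕ) + 1)) ∧
          Gasket.Mw lam w =
            !![x ^ j, -x ^ (2 ^ m - j); -x ^ (j + 1), x ^ (2 ^ m - j - 1)] *
              (!![1, -x ^ 2 ^ m; -x ^ 2 ^ m, 1])⁻¹ := by
  obtain ⟨hm0, hm1⟩ := Gasket.iterate_shift_mem hlam0 hlam1 m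
  have hB := Gasket.far_pos hm0 hm1
  have hd : Gasket.StartsWithOnes m lam := hdigits
  rw [Gasket.eta1_eq hm0 hm1, Gasket.eta2_eq hm0 hm1, Gasket.eta1_eq hlam0 hlam1,
    Gasket.eta2_eq hlam0 hlam1]
  refine ⟨Gasket.existsUnique_half_add_inv ((one_lt_div hB).2 (Gasket.far_lt_near hm0 hm1)), ?_, ?_⟩
  · intro w hw u hu hX
    have h := hu.agreesWithSol hlam0 hlam1 hX
    rw [h.normalDeriv_one hlam0 hlam1, h.normalDeriv_two hlam0 hlam1]
    exact h.cellNormalDeriv_eq hlam0 hlam1 hd hw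
  · intro x hx hx1 hxr
    have hr : Gasket.near (Gasket.shift^[m] lam) =
        Gasket.far (Gasket.shift^[m] lam) * ((x + x⁻¹) / 2) := by
      rw [← hxr, mul_div_cancel₀ _ hB.ne']
    have hfar := hd.far_eq hlam0 hlam1 hx hx1 hr
    refine ⟨⟨?_, hfar⟩, fun w hw => hd.exists_Mw_eq hlam0 hlam1 hx hx1 hr hw⟩
    rw [hd.near_eq hlam0 hlam1 hx hr, hfar, hr]
    have e : x + x⁻¹ ≠ 0 := by positivity
    generalize x ^ 2 ^ m + (x ^ 2 ^ m)⁻¹ = c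
    generalize x ^ 2 ^ m - (x ^ 2 ^ m)⁻¹ = d
    generalize x - x⁻¹ = b
    generalize x + x⁻¹ = a at *
    field_simp
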